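/- Let $\mathfrak H$ and $\mathfrak H_n$, $n\in\mathbb N$, be separable complex Hilbert spaces, $J_n:\mathfrak H\to\mathfrak H_n$ bounded linear operators, and $A$, $A_n$ (possibly unbounded) self-adjoint operators in $\mathfrak H$, $\mathfrak H_n$. Let $R_A(z)=(A-z)^{-1}$ denote the resolvent, $P_A$ the projection-valued spectral measure of $A$, i.e. $A=\int_{\mathbb R}\lambda\,dP_A(\lambda)$, and $\Gamma=\mathbb C\setminus\overline{\sigma(A)\cup\bigcup_n\sigma(A_n)}$. Suppose that $A_n$ converges to $A$ in the generalized strong resolvent sense, that is, there is a constant $C$ with $\|J_n\|\le C$ for all $n$, $J_n^*J_n\psi\to\psi$ for all $\psi\in\mathfrak H$, and for one $z\in\Gamma$ $$\lim_{n\to\infty}\|J_n^*R_{A_n}(z)J_n\psi-R_A(z)\psi\|=0,\qquad \psi\in\mathfrak H,$$ where, in case this $z$ is real, it is required in addition that $\lim_{n\to\infty}\|R_{A_n}(z)J_n\psi-J_nR_A(z)\psi\|=0$ for all $\psi\in\mathfrak H$. Let $\lambda_0,\lambda_1\in\mathbb R$ with $P_A(\{\lambda_0\})=P_A(\{\lambda_1\})=0$.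 Then, as strong limits, $$\operatorname*{s-lim}_{n\to\infty}J_n^*P_{A_n}((\lambda_0,\lambda_1))J_n=\operatorname*{s-lim}_{n\to\infty}J_n^*P_{A_n}([\lambda_0,\lambda_1])J_n=P_A((\lambda_0,\lambda_1))=P_A([\lambda_0,\lambda_1]).$$ Moreover, with dimensions in $\{0,1,2,\dots\}\cup\{\infty\}$ and $0\cdot\infty=0$, $$\dim\operatorname{ran}P_A((\lambda_0,\lambda_1))\le\liminf_{n\to\infty}\dim\operatorname{ran}J_n^*P_{A_n}((\lambda_0,\lambda_1))J_n\le\limsup_{n\to\infty}\|J_n\|^2\cdot\liminf_{n\to\infty}\dim\operatorname{ran}P_{A_n}((\lambda_0,\lambda_1)).$$ -/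

import Mathlib

open Filter Topology MeasureTheory
open scoped ENNReal

noncomputable section

/-! ### Resolvent set, spectrum and resolvent of an unbounded operator -/

namespace UnboundedOp

variable {H : Type*} [NormedAddCommGroup H] [InnerProductSpace ℂ H]

/-- The bounded operator `R` is a two-sided inverse of `A - z : D(A) → H`. -/
def IsResolventAt (A : H →ₗ.[ℂ] H) (z : ℂ) (R : H →L[ℂ] H) : Prop :=
  (∀ ψ : A.domain, R (A ψ - z • (ψ : H)) = ψ) ∧
    ∀ φ : H, ∃ ψ : A.domain, (ψ : H) = R φ ∧ A ψ - z • (ψ : H) = φ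

/-- The resolvent set `ρ(A)`: all `z` for which `A - z` has a bounded everywhere defined inverse. -/
def resolventSet (A : H →ₗ.[ℂ] H) : Set ℂ := {z | ∃ R, IsResolventAt A z R}

/-- The spectrum `σ(A) = ℂ \ ρ(A)`. -/
def spectrum (A : H →ₗ.[ℂ] H) : Set ℂ := (resolventSet A)ᶜ

open Classical in
/-- The resolvent `R_A(z) = (A - z)⁻¹` for `z ∈ ρ(A)` (and `0` for `z ∈ σ(A)`). -/
def resolvent (A : H →ₗ.[ℂ] H) (z : ℂ) : H →L[ℂ] H :=
  if h : ∃ R, IsResolventAt A z R then h.choose else 0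

/-- The bounded inverse of `A - z` is unique. -/
theorem IsResolventAt.unique {A : H →ₗ.[ℂ] H} {z : ℂ} {R S : H →L[ℂ] H}
    (hR : IsResolventAt A z R) (hS : IsResolventAt A z S) : R = S := by
  ext φ
  obtain ⟨ψ, h1, h2⟩ := hS.2 φ
  rw [← h1, ← hR.1 ψ, h2]

theorem IsResolventAt.resolvent_eq {A : H →ₗ.[ℂ] H} {z : ℂ} {R : H →L[ℂ] H}
    (hR : IsResolventAt A z R) : resolvent A z = R := by
  have h : ∃ R, IsResolventAt A z R := ⟨R, hR⟩
  rw [resolvent, dif_pos h]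
  exact h.choose_spec.unique hR

end UnboundedOp

/-! ### Projection-valued measures and the spectral projections of a self-adjoint operator -/

/-- A projection-valued measure on the Borel sets of `ℝ`: orthogonal projections `P(Ω)` with
`P(ℝ) = 1` that are strongly countably additive. As for Mathlib's vector measures, the value on
sets that are not Borel is `0` by convention. -/
structure ProjectionValuedMeasure (H : Type*) [NormedAddCommGroup H] [InnerProductSpace ℂ H]
    [CompleteSpace H] where
  proj : Set ℝ → H →L[ℂ] H
  isStarProjection : ∀ Ω, MeasurableSet Ω → IsStarProjection (proj Ω)
  proj_of_not_measurableSet : ∀ Ω, ¬ MeasurableSet Ω → proj Ω = 0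
  proj_univ : proj Set.univ = 1
  hasSum_iUnion : ∀ Ω : ℕ → Set ℝ, (∀ i, MeasurableSet (Ω i)) →
    Pairwise (Function.onFun Disjoint Ω) →
    ∀ ψ : H, HasSum (fun i => proj (Ω i) ψ) (proj (⋃ i, Ω i) ψ)

namespace ProjectionValuedMeasure

variable {H : Type*} [NormedAddCommGroup H] [InnerProductSpace ℂ H] [CompleteSpace H]

theorem proj_empty (P : ProjectionValuedMeasure H) : P.proj ∅ = 0 := by
  ext ψ
  have h := P.hasSum_iUnion (fun _ => ∅) (fun _ => MeasurableSet.empty)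
    (fun _ _ _ => by simp [Function.onFun]) ψ
  have := h.summable.tendsto_atTop_zero
  simpa using (tendsto_const_nhds_iff.1 this)

theorem inner_proj_self (P : ProjectionValuedMeasure H) {Ω : Set ℝ} (hΩ : MeasurableSet Ω)
    (ψ : H) : inner ℂ ψ (P.proj Ω ψ) = ((‖P.proj Ω ψ‖ ^ 2 : ℝ) : ℂ) := by
  have h := P.isStarProjection Ω hΩ
  have h1 : P.proj Ω (P.proj Ω ψ) = P.proj Ω ψ := by
    rw [← mul_apply_eq_comp, h.isIdempotentElem.eq]
  have h2 : ContinuousLinearMap.adjoint (P.proj Ω) = P.proj Ω := h.isSelfAdjoint.star_eq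
  conv_lhs => rw [← h1]
  rw [← ContinuousLinearMap.adjoint_inner_left, h2, inner_self_eq_norm_sq_to_K]
  norm_cast

/-- The measure `μ_ψ(Ω) = ‖P(Ω) ψ‖² = ⟨ψ, P(Ω) ψ⟩` on `ℝ`. -/
def measure (P : ProjectionValuedMeasure H) (ψ : H) : Measure ℝ :=
  Measure.ofMeasurable (fun Ω _ => ENNReal.ofReal (‖P.proj Ω ψ‖ ^ 2))
    (by simp [P.proj_empty])
    (by
      intro Ω hΩ hd
      have h := (P.hasSum_iUnion Ω hΩ hd ψ).mapL (innerSL ℂ ψ)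
      simp only [innerSL_apply_apply, P.inner_proj_self (MeasurableSet.iUnion hΩ)] at h
      simp only [fun i => P.inner_proj_self (hΩ i)] at h
      have h' : HasSum (fun i => ‖P.proj (Ω i) ψ‖ ^ 2) (‖P.proj (⋃ i, Ω i) ψ‖ ^ 2) :=
        Complex.hasSum_ofReal.1 h
      rw [← h'.tsum_eq, ENNReal.ofReal_tsum_of_nonneg (fun _ => by positivity) h'.summable])

theorem measure_apply (P : ProjectionValuedMeasure H) (ψ : H) {Ω : Set ℝ}
    (hΩ : MeasurableSet Ω) : P.measure ψ Ω = ENNReal.ofReal (‖P.proj Ω ψ‖ ^ 2) :=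
  Measure.ofMeasurable_apply Ω hΩ

/-- `A = ∫ λ dP(λ)`: the domain of `A` is `{ψ | ∫ λ² dμ_ψ(λ) < ∞}`, and
`⟨ψ, A ψ⟩ = ∫ λ dμ_ψ(λ)` for `ψ` in it. -/
structure Represents (P : ProjectionValuedMeasure H) (A : H →ₗ.[ℂ] H) : Prop where
  mem_domain_iff : ∀ ψ : H, ψ ∈ A.domain ↔ ∫⁻ t, ENNReal.ofReal (t ^ 2) ∂(P.measure ψ) < ∞
  inner_apply : ∀ ψ : A.domain,
    inner ℂ (ψ : H) (A ψ) = ((∫ t, t ∂(P.measure (ψ : H)) : ℝ) : ℂ)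

end ProjectionValuedMeasure

namespace UnboundedOp

variable {H : Type*} [NormedAddCommGroup H] [InnerProductSpace ℂ H] [CompleteSpace H]

open Classical in
/-- The spectral projection `P_A(Ω)` of a self-adjoint operator `A`: the value at `Ω` of the
(unique) projection-valued measure `P` with `A = ∫ λ dP(λ)`. -/
def spectralProjection (A : H →ₗ.[ℂ] H) (Ω : Set ℝ) : H →L[ℂ] H :=
  if h : ∃ P : ProjectionValuedMeasure H, P.Represents A then h.choose.proj Ω else 0

end UnboundedOp

/-- `dim ran T`, as an extended nonnegative number (`∞` if the range is infinite-dimensional). -/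
def dimRange {H K : Type*} [NormedAddCommGroup H] [InnerProductSpace ℂ H]
    [NormedAddCommGroup K] [InnerProductSpace ℂ K] (T : H →L[ℂ] K) : ℝ≥0∞ :=
  ((Cardinal.toENat (Module.rank ℂ (LinearMap.range (T : H →ₗ[ℂ] K))) : ℕ∞) : ℝ≥0∞)

/-! ### Generalized strong resolvent convergence -/

section Convergence

variable {H : Type*} [NormedAddCommGroup H] [InnerProductSpace ℂ H] [CompleteSpace H]
  {Hn : ℕ → Type*} [∀ n, NormedAddCommGroup (Hn n)] [∀ n, InnerProductSpace ℂ (Hn n)]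
  [∀ n, CompleteSpace (Hn n)]

/-- `Γ = ℂ \ Σ`, where `Σ` is the closure of `σ(A) ∪ ⋃ₙ σ(Aₙ)`. -/
def commonResolventSet (An : ∀ n, Hn n →ₗ.[ℂ] Hn n) (A : H →ₗ.[ℂ] H) : Set ℂ :=
  (closure (UnboundedOp.spectrum A ∪ ⋃ n, UnboundedOp.spectrum (An n)))ᶜ

/-- `Aₙ → A` in generalized strong resolvent sense, with respect to `Jₙ : H → Hₙ`:
`‖Jₙ‖ ≤ C`, `Jₙ* Jₙ → 1` strongly and `Jₙ* R_{Aₙ}(z) Jₙ → R_A(z)` strongly for one `z ∈ Γ`.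
If this `z` is real, then the stronger `R_{Aₙ}(z) Jₙ ψ - Jₙ R_A(z) ψ → 0` is required too; for
self-adjoint operators and non-real `z` that condition is automatic. -/
structure GenStrongResolventConv (J : ∀ n, H →L[ℂ] Hn n)
    (An : ∀ n, Hn n →ₗ.[ℂ] Hn n) (A : H →ₗ.[ℂ] H) : Prop where
  bounded : ∃ C : ℝ, ∀ n, ‖J n‖ ≤ C
  tendsto_adjoint_comp : ∀ ψ : H,
    Tendsto (fun n => ContinuousLinearMap.adjoint (J n) (J n ψ)) atTop (𝓝 ψ)
  tendsto_resolvent : ∃ z ∈ commonResolventSet An A,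
    (∀ ψ : H, Tendsto (fun n => ContinuousLinearMap.adjoint (J n)
      (UnboundedOp.resolvent (An n) z (J n ψ))) atTop (𝓝 (UnboundedOp.resolvent A z ψ))) ∧
    (z.im = 0 → ∀ ψ : H, Tendsto (fun n => ‖UnboundedOp.resolvent (An n) z (J n ψ) -
      J n (UnboundedOp.resolvent A z ψ)‖) atTop (𝓝 0))

end Convergence

end

/-! The theorem is reduced to weak convergence of scalar measures. Let `z` be the point where
resolvents converge and let `d > 0` be the radius of a ball about `z` that misses all the spectra.
The map `t ↦ (t - z)⁻¹` carries the spectral measure of `ψ` for `A`, and that of `J n ψ` for `An n`,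
into one fixed closed disk of radius `d⁻¹`. Since `Rn J n - J n R → 0` strongly, the same holds for
all powers. Hence the inner products of powers of resolvents converge, and these are exactly the
integrals of the monomials in `w` and its conjugate. By Stone–Weierstrass the transported measures
converge weakly (`tendsto_integral_comp`), and the portmanteau theorem turns this into `‖Pn(Ω) J n
ψ‖² → ‖P(Ω) ψ‖²` whenever the frontier of `Ω` is null (`tendsto_norm_proj_sq`). Polarization and
expansion of a square upgrade these diagonal limits to strong convergence
(`tendsto_adjoint_comp_of_tendsto_norm_sq`). For an interval the frontier consists of at most the
two endpoints, which are null by assumption.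

For non-real `z`, only `J* Rn J → R` is given. The identity `Im ⟨ψ, R ψ⟩ = Im z ‖R ψ‖²` then yields
convergence of norms, hence `Rn J n - J n R → 0` (`tendsto_norm_resolvent_sub`).

The first dimension bound is lower semicontinuity of rank under strong limits. The second holds
because composition does not raise rank and `limsup ‖J n‖² ≥ 1` unless `H = 0`.

The definition of `spectralProjection` is nontrivial only if a representing measure exists, so the
spectral theorem is proved as well (`exists_represents`), through the continuous functional calculus
of the normal resolvent at `i`. -/

noncomputable section

/-! ### Algebra of projection-valued measures. -/

namespace ProjectionValuedMeasure

variable {H : Type*} [NormedAddCommGroup H] [InnerProductSpace ℂ H] [CompleteSpace H]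
  (P : ProjectionValuedMeasure H)

theorem proj_union {E F : Set ℝ} (hE : MeasurableSet E) (hF : MeasurableSet F)
    (hd : Disjoint E F) (ψ : H) : P.proj (E ∪ F) ψ = P.proj E ψ + P.proj F ψ := by
  let Ω : ℕ → Set ℝ := fun i => if i = 0 then E else if i = 1 then F else ∅
  have hΩ : ⋃ i, Ω i = E ∪ F := by
    ext t
    simp only [Set.mem_iUnion, Set.mem_union, Ω]
    constructor
    · rintro ⟨i, hi⟩
      split_ifs at hi <;> simp_all
    · rintro (h | h)
      · exact ⟨0, by simpa using h⟩
      · exact ⟨1, by simpa using h⟩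
  have h := P.hasSum_iUnion Ω
    (fun i => by simp only [Ω]; split_ifs <;> first | assumption | exact MeasurableSet.empty)
    (fun i j hij => by
      simp only [Function.onFun, Ω]
      split_ifs <;> first | exact hd | exact hd.symm | simp_all) ψ
  have h2 : HasSum (fun i => P.proj (Ω i) ψ) (∑ i ∈ Finset.range 2, P.proj (Ω i) ψ) := by
    refine hasSum_sum_of_ne_finset_zero fun i hi => ?_
    have : ¬ i < 2 := by simpa using hi
    simp [Ω, show i ≠ 0 by omega, show i ≠ 1 by omega, P.proj_empty]
  rw [← hΩ, h.unique h2]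
  simp [Finset.sum_range_succ, Ω]

theorem proj_add_proj_compl {E : Set ℝ} (hE : MeasurableSet E) (ψ : H) :
    P.proj E ψ + P.proj Eᶜ ψ = ψ := by
  rw [← P.proj_union hE hE.compl disjoint_compl_right, Set.union_compl_self, P.proj_univ]
  rfl

theorem adjoint_proj {E : Set ℝ} (hE : MeasurableSet E) :
    ContinuousLinearMap.adjoint (P.proj E) = P.proj E :=
  (P.isStarProjection E hE).isSelfAdjoint.star_eq

theorem inner_proj_left {E : Set ℝ} (hE : MeasurableSet E) (φ ψ : H) :
    inner ℂ (P.proj E φ) ψ = inner ℂ φ (P.proj E ψ) := by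
  rw [← ContinuousLinearMap.adjoint_inner_right, P.adjoint_proj hE]

theorem proj_proj_self {E : Set ℝ} (hE : MeasurableSet E) (ψ : H) :
    P.proj E (P.proj E ψ) = P.proj E ψ := by
  rw [← mul_apply_eq_comp, (P.isStarProjection E hE).isIdempotentElem.eq]

theorem norm_sq_union {E F : Set ℝ} (hE : MeasurableSet E) (hF : MeasurableSet F)
    (hd : Disjoint E F) (ψ : H) :
    ‖P.proj (E ∪ F) ψ‖ ^ 2 = ‖P.proj E ψ‖ ^ 2 + ‖P.proj F ψ‖ ^ 2 := by
  have h := P.inner_proj_self (hE.union hF) ψ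
  rw [P.proj_union hE hF hd, inner_add_right, P.inner_proj_self hE, P.inner_proj_self hF] at h
  rw [P.proj_union hE hF hd]
  exact_mod_cast h.symm

theorem norm_sq_compl {E : Set ℝ} (hE : MeasurableSet E) (ψ : H) :
    ‖ψ‖ ^ 2 = ‖P.proj E ψ‖ ^ 2 + ‖P.proj Eᶜ ψ‖ ^ 2 := by
  rw [← P.norm_sq_union hE hE.compl disjoint_compl_right, Set.union_compl_self, P.proj_univ]
  rfl

theorem norm_proj_le {E : Set ℝ} (hE : MeasurableSet E) (ψ : H) : ‖P.proj E ψ‖ ≤ ‖ψ‖ := by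
  have := P.norm_sq_compl hE ψ
  nlinarith [norm_nonneg (P.proj E ψ), norm_nonneg ψ, sq_nonneg ‖P.proj Eᶜ ψ‖]

/-- On a vector of the range of `P(F)`, additivity gives `‖P(E ∪ F) x‖² = ‖P(E) x‖² + ‖x‖²`, and a
projection cannot increase the norm. Multiplicativity thus follows from additivity. -/
theorem proj_proj_of_disjoint {E F : Set ℝ} (hE : MeasurableSet E) (hF : MeasurableSet F)
    (hd : Disjoint E F) (ψ : H) : P.proj E (P.proj F ψ) = 0 := by
  have h1 := P.norm_sq_union hE hF hd (P.proj F ψ)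
  have h2 := P.norm_proj_le (hE.union hF) (P.proj F ψ)
  rw [P.proj_proj_self hF] at h1
  have h3 : ‖P.proj E (P.proj F ψ)‖ ^ 2 ≤ 0 := by
    nlinarith [norm_nonneg (P.proj (E ∪ F) (P.proj F ψ)), norm_nonneg (P.proj F ψ)]
  simpa using le_antisymm h3 (sq_nonneg _)

theorem proj_proj {E F : Set ℝ} (hE : MeasurableSet E) (hF : MeasurableSet F) (ψ : H) :
    P.proj E (P.proj F ψ) = P.proj (E ∩ F) ψ := by
  have h1 : P.proj F ψ = P.proj (E ∩ F) ψ + P.proj (F \ E) ψ := by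
    rw [← P.proj_union (hE.inter hF) (hF.diff hE)
      (Set.disjoint_sdiff_right.mono_left Set.inter_subset_left), Set.inter_comm,
      Set.inter_union_sdiff]
  have h2 (φ : H) : P.proj E φ = P.proj (E ∩ F) φ + P.proj (E \ F) φ := by
    rw [← P.proj_union (hE.inter hF) (hE.diff hF)
      (Set.disjoint_sdiff_right.mono_left Set.inter_subset_right), Set.inter_union_sdiff]
  rw [h1, map_add, P.proj_proj_of_disjoint hE (hF.diff hE) Set.disjoint_sdiff_right, add_zero, h2,
    P.proj_proj_self (hE.inter hF), P.proj_proj_of_disjoint (hE.diff hF) (hE.inter hF)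
      (Set.disjoint_sdiff_left.mono_right Set.inter_subset_right), add_zero]

instance isFiniteMeasure_measure (ψ : H) : IsFiniteMeasure (P.measure ψ) :=
  ⟨by rw [P.measure_apply ψ MeasurableSet.univ]; exact ENNReal.ofReal_lt_top⟩

theorem measureReal_apply (ψ : H) {E : Set ℝ} (hE : MeasurableSet E) :
    (P.measure ψ).real E = ‖P.proj E ψ‖ ^ 2 := by
  rw [Measure.real, P.measure_apply ψ hE, ENNReal.toReal_ofReal (by positivity)]

theorem measureReal_univ (ψ : H) : (P.measure ψ).real Set.univ = ‖ψ‖ ^ 2 := by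
  rw [P.measureReal_apply ψ MeasurableSet.univ, P.proj_univ]; rfl

theorem measure_proj {E : Set ℝ} (hE : MeasurableSet E) (ψ : H) :
    P.measure (P.proj E ψ) = (P.measure ψ).restrict E := by
  ext F hF
  rw [Measure.restrict_apply hF, P.measure_apply _ hF, P.measure_apply _ (hF.inter hE),
    P.proj_proj hF hE]

theorem measure_smul (c : ℂ) (ψ : H) :
    P.measure (c • ψ) = ENNReal.ofReal (‖c‖ ^ 2) • P.measure ψ := by
  ext F hF
  rw [Measure.smul_apply, P.measure_apply _ hF, P.measure_apply _ hF, map_smul, norm_smul,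
    mul_pow, ENNReal.ofReal_mul (by positivity), smul_eq_mul]

/-- For every `F` the vectors `P(F) x` and `P(F) y` stay orthogonal because the projections commute,
so Pythagoras applies set by set. -/
theorem measure_add_of_proj {E : Set ℝ} (hE : MeasurableSet E) {x y : H} (hx : P.proj E x = x)
    (hy : P.proj E y = 0) : P.measure (x + y) = P.measure x + P.measure y := by
  ext F hF
  rw [Measure.add_apply, P.measure_apply _ hF, P.measure_apply _ hF, P.measure_apply _ hF,
    ← ENNReal.ofReal_add (by positivity) (by positivity), map_add]
  have h : inner ℂ (P.proj F x) (P.proj F y) = 0 := by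
    rw [← hx, P.proj_proj hF hE, Set.inter_comm, ← P.proj_proj hE hF, P.inner_proj_left hE,
      P.proj_proj hE hF, Set.inter_comm, ← P.proj_proj hF hE, hy, map_zero, inner_zero_right]
  have := norm_add_sq_eq_norm_sq_add_norm_sq_of_inner_eq_zero _ _ h
  congr 1
  linarith

/-- If `⟨ψ, T ψ⟩` depends only on the spectral measure of `ψ`, then `T` has no matrix elements
between the ranges of complementary projections. -/
theorem inner_eq_zero_of_measure_determined {D : Submodule ℂ H} (T : D →ₗ[ℂ] H)
    (hT : ∀ ψ φ : D, P.measure (ψ : H) = P.measure (φ : H) →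
      inner ℂ (ψ : H) (T ψ) = inner ℂ (φ : H) (T φ))
    {E : Set ℝ} (hE : MeasurableSet E) {x y : D} (hx : P.proj E (x : H) = x)
    (hy : P.proj E (y : H) = 0) :
    inner ℂ (x : H) (T y) = 0 ∧ inner ℂ (y : H) (T x) = 0 := by
  -- Rotating the phase of `y` does not change the spectral measure of `x + y`, so the quadratic
  -- form is unchanged too. The phases `-1`, `i`, `-i` suffice to separate the two cross terms and
  -- show that both vanish.
  have key (c : ℂ) (hc : ‖c‖ = 1) : inner ℂ ((x + c • y : D) : H) (T (x + c • y)) =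
      inner ℂ ((x + y : D) : H) (T (x + y)) := by
    apply hT
    push_cast
    rw [P.measure_add_of_proj hE hx hy, P.measure_add_of_proj hE hx (by rw [map_smul, hy, smul_zero]),
      P.measure_smul, hc]
    simp
  have h1 := key (-1) (by simp)
  have h2 := key Complex.I (by simp)
  have h3 := key (-Complex.I) (by simp)
  simp only [Submodule.coe_add, Submodule.coe_smul, map_add, map_smul, inner_add_left,
    inner_add_right, inner_smul_left, inner_smul_right, map_neg, map_one, Complex.conj_I] at h1 h2 h3
  constructor
  · linear_combination (-1 / 4 : ℂ) * h1 - (1 / 4 : ℂ) * Complex.I * (h2 - h3) +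
      (1 / 2 : ℂ) * (inner ℂ (x : H) (T y) - inner ℂ (y : H) (T x)) * Complex.I_sq
  · linear_combination (-1 / 4 : ℂ) * h1 + (1 / 4 : ℂ) * Complex.I * (h2 - h3) -
      (1 / 2 : ℂ) * (inner ℂ (x : H) (T y) - inner ℂ (y : H) (T x)) * Complex.I_sq

end ProjectionValuedMeasure

/-! ### Polarization and weak operator integrals. -/

theorem inner_apply_polarization {H : Type*} [NormedAddCommGroup H] [InnerProductSpace ℂ H]
    (T : H →ₗ[ℂ] H) (x y : H) :
    inner ℂ y (T x) = (inner ℂ (x + y) (T (x + y)) - inner ℂ (x - y) (T (x - y)) +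
      Complex.I * inner ℂ (x + Complex.I • y) (T (x + Complex.I • y)) -
      Complex.I * inner ℂ (x - Complex.I • y) (T (x - Complex.I • y))) / 4 := by
  simp only [map_add, map_sub, map_smul, inner_add_left, inner_sub_left,
    inner_add_right, inner_sub_right, inner_smul_left, inner_smul_right, Complex.conj_I]
  linear_combination (1 / 2 : ℂ) * (inner ℂ y (T x) - inner ℂ x (T y)) * Complex.I_sq

theorem ContinuousLinearMap.ext_inner_apply {H : Type*} [NormedAddCommGroup H]
    [InnerProductSpace ℂ H] {S T : H →L[ℂ] H}
    (h : ∀ ψ : H, inner ℂ ψ (S ψ) = inner ℂ ψ (T ψ)) : S = T := by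
  ext x
  refine ext_inner_left ℂ fun y => ?_
  have h1 := inner_apply_polarization (S : H →ₗ[ℂ] H) x y
  have h2 := inner_apply_polarization (T : H →ₗ[ℂ] H) x y
  simp only [ContinuousLinearMap.coe_coe, h] at h1 h2
  rw [h1, h2]

/-- Transfer of a complex linear relation between finite measures from sets to bounded
functions. -/
theorem integral_mul_eq_of_setIntegral_eq {X : Type*} [MeasurableSpace X] {μ₀ μ₁ μ₂ μ₃ μ₄ : Measure X}
    [IsFiniteMeasure μ₀] [IsFiniteMeasure μ₁] [IsFiniteMeasure μ₂] [IsFiniteMeasure μ₃]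
    [IsFiniteMeasure μ₄] {f : X → ℂ} (hf : Integrable f μ₀)
    (h : ∀ E, MeasurableSet E → ∫ t in E, f t ∂μ₀ = (μ₁.real E - μ₂.real E +
      Complex.I * μ₃.real E - Complex.I * μ₄.real E) / 4) {g : X → ℂ} (hg : Measurable g)
    {C : ℝ} (hC : ∀ t, ‖g t‖ ≤ C) :
    ∫ t, g t * f t ∂μ₀ = (∫ t, g t ∂μ₁ - ∫ t, g t ∂μ₂ +
      Complex.I * ∫ t, g t ∂μ₃ - Complex.I * ∫ t, g t ∂μ₄) / 4 := by
  have hbi (μ : Measure X) [IsFiniteMeasure μ] (g : SimpleFunc X ℂ) : Integrable g μ :=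
    SimpleFunc.integrable_of_isFiniteMeasure g
  have hbm (g : SimpleFunc X ℂ) : Integrable (fun t => g t * f t) μ₀ := by
    obtain ⟨D, hD⟩ := g.exists_forall_norm_le
    exact hf.bdd_mul g.measurable.aestronglyMeasurable (Eventually.of_forall hD)
  have hs (g : SimpleFunc X ℂ) : ∫ t, g t * f t ∂μ₀ = (∫ t, g t ∂μ₁ - ∫ t, g t ∂μ₂ +
      Complex.I * ∫ t, g t ∂μ₃ - Complex.I * ∫ t, g t ∂μ₄) / 4 := by
    induction g using SimpleFunc.induction with
    | const c hs =>
      rename_i s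
      have e1 : (fun t => (SimpleFunc.piecewise s hs (SimpleFunc.const X c)
          (SimpleFunc.const X 0)) t * f t) = s.indicator (fun t => c * f t) := by
        ext t
        by_cases ht : t ∈ s <;> simp [ht]
      have e2 : ⇑(SimpleFunc.piecewise s hs (SimpleFunc.const X c)
          (SimpleFunc.const X 0)) = s.indicator (fun _ => c) := by
        ext t
        by_cases ht : t ∈ s <;> simp [ht]
      rw [e1, e2]
      simp only [integral_indicator hs, integral_const_mul, setIntegral_const, h s hs,
        Complex.real_smul]
      ring
    | add hd hg1 hg2 =>
      rename_i g1 g2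
      have e1 : (fun t => (g1 + g2) t * f t) = fun t => g1 t * f t + g2 t * f t := by
        ext t
        simp [add_mul]
      have e2 : ⇑(g1 + g2) = fun t => g1 t + g2 t := rfl
      rw [e1, e2, integral_add (hbm g1) (hbm g2), hg1, hg2]
      simp only [integral_add (hbi _ g1) (hbi _ g2)]
      ring
  -- The simple approximants keep the bound `C`, so dominated convergence applies to all five
  -- integrals.
  have hsm := hg.stronglyMeasurable
  have hlim (t : X) : Tendsto (fun n => hsm.approxBounded C n t) atTop (𝓝 (g t)) :=
    hsm.tendsto_approxBounded_of_norm_le (hC t)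
  have hC0 (t : X) : 0 ≤ C := (norm_nonneg _).trans (hC t)
  have hlint (μ : Measure X) [IsFiniteMeasure μ] :
      Tendsto (fun n => ∫ t, hsm.approxBounded C n t ∂μ) atTop (𝓝 (∫ t, g t ∂μ)) :=
    tendsto_integral_of_dominated_convergence (fun _ => C)
      (fun n => (hsm.approxBounded C n).measurable.aestronglyMeasurable) (integrable_const _)
      (fun n => Eventually.of_forall fun t => hsm.norm_approxBounded_le (hC0 t) n t)
      (Eventually.of_forall hlim)
  refine tendsto_nhds_unique (f := fun n => ∫ t, hsm.approxBounded C n t * f t ∂μ₀) (l := atTop) ?_ ?_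
  · refine tendsto_integral_of_dominated_convergence (fun t => C * ‖f t‖)
      (fun n => (hsm.approxBounded C n).measurable.aestronglyMeasurable.mul hf.1)
      (hf.norm.const_mul _) (fun n => Eventually.of_forall fun t => ?_)
      (Eventually.of_forall fun t => (hlim t).mul tendsto_const_nhds)
    rw [norm_mul]
    gcongr
    exact hsm.norm_approxBounded_le (hC0 t) n t
  · simp only [hs]
    exact ((((hlint μ₁).sub (hlint μ₂)).add ((hlint μ₃).const_mul _)).sub
      ((hlint μ₄).const_mul _)).div_const _

namespace ProjectionValuedMeasure

variable {H : Type*} [NormedAddCommGroup H] [InnerProductSpace ℂ H] [CompleteSpace H]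
  {P : ProjectionValuedMeasure H}

/-- `F = ∫ f dP` in the weak sense. -/
structure HasIntegral (P : ProjectionValuedMeasure H) (f : ℝ → ℂ) (F : H →L[ℂ] H) : Prop where
  measurable : Measurable f
  integrable : ∀ ψ, Integrable f (P.measure ψ)
  inner_apply : ∀ ψ, inner ℂ ψ (F ψ) = ∫ t, f t ∂(P.measure ψ)

namespace HasIntegral

variable {f g : ℝ → ℂ} {F G : H →L[ℂ] H}

theorem proj_apply_proj (h : P.HasIntegral f F) {E : Set ℝ} (hE : MeasurableSet E) {x y : H}
    (hx : P.proj E x = x) (hy : P.proj E y = 0) : inner ℂ x (F y) = 0 ∧ inner ℂ y (F x) = 0 :=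
  P.inner_eq_zero_of_measure_determined (D := ⊤) (F.toLinearMap.comp (Submodule.subtype ⊤))
    (fun ψ φ e => by
      have := h.inner_apply ψ
      rw [e, ← h.inner_apply] at this
      exact this) hE (x := ⟨x, trivial⟩) (y := ⟨y, trivial⟩) hx hy

/-- Both off-diagonal blocks of `F` with respect to `P(E)` and `P(Eᶜ)` vanish, since the quadratic
form of `F` depends only on spectral measures. -/
theorem proj_comm (h : P.HasIntegral f F) {E : Set ℝ} (hE : MeasurableSet E) (ψ : H) :
    P.proj E (F ψ) = F (P.proj E ψ) := by
  have h0 (φ : H) : P.proj E (P.proj Eᶜ φ) = 0 :=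
    P.proj_proj_of_disjoint hE hE.compl disjoint_compl_right φ
  have h1 : P.proj E (F (P.proj Eᶜ ψ)) = 0 := by
    refine ext_inner_left ℂ fun φ => ?_
    rw [← P.inner_proj_left hE, (h.proj_apply_proj hE (P.proj_proj_self hE φ) (h0 ψ)).1,
      inner_zero_right]
  have h2 : P.proj Eᶜ (F (P.proj E ψ)) = 0 := by
    refine ext_inner_left ℂ fun φ => ?_
    rw [← P.inner_proj_left hE.compl, (h.proj_apply_proj hE (P.proj_proj_self hE ψ) (h0 φ)).2,
      inner_zero_right]
  have h3 := P.proj_add_proj_compl hE (F (P.proj E ψ))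
  rw [h2, add_zero] at h3
  conv_lhs => rw [← P.proj_add_proj_compl hE ψ]
  rw [map_add, map_add, h1, add_zero, h3]

theorem inner_apply_proj (h : P.HasIntegral f F) {E : Set ℝ} (hE : MeasurableSet E) (ψ : H) :
    inner ℂ ψ (F (P.proj E ψ)) = ∫ t in E, f t ∂(P.measure ψ) := by
  rw [← P.measure_proj hE, ← h.inner_apply, P.inner_proj_left hE, h.proj_comm hE,
    P.proj_proj_self hE]

theorem norm_setIntegral_le (h : P.HasIntegral f F) {E : Set ℝ} (hE : MeasurableSet E) (ψ : H) :
    ‖∫ t in E, f t ∂(P.measure ψ)‖ ≤ ‖F‖ * (P.measure ψ).real E := by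
  rw [← P.measure_proj hE, ← h.inner_apply, P.measureReal_apply ψ hE]
  calc _ ≤ ‖P.proj E ψ‖ * (‖F‖ * ‖P.proj E ψ‖) :=
        (norm_inner_le_norm _ _).trans (by gcongr; exact F.le_opNorm _)
    _ = _ := by ring

/-- The averages of `f` over every set are bounded by `‖F‖`, hence so are the real parts of `c f`
for `c = ±1, ±i`, almost everywhere. The factor `2` comes from adding the bounds for real and
imaginary parts; any fixed multiple of `‖F‖` would serve. -/
theorem ae_norm_le (h : P.HasIntegral f F) (ψ : H) :
    ∀ᵐ t ∂(P.measure ψ), ‖f t‖ ≤ 2 * ‖F‖ := by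
  have key (c : ℂ) (hc : ‖c‖ = 1) : (fun t => (c * f t).re) ≤ᵐ[P.measure ψ] fun _ => ‖F‖ := by
    have hi := (h.integrable ψ).const_mul c
    refine ae_le_of_forall_setIntegral_le hi.re (integrable_const _) fun E hE _ => ?_
    rw [setIntegral_const, smul_eq_mul, mul_comm]
    have : ∫ t in E, (c * f t).re ∂(P.measure ψ) = (c * ∫ t in E, f t ∂(P.measure ψ)).re := by
      rw [← integral_const_mul]
      exact integral_re hi.integrableOn
    rw [this]
    refine (Complex.re_le_norm _).trans ?_
    rw [norm_mul, hc, one_mul]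
    exact h.norm_setIntegral_le hE ψ
  filter_upwards [key 1 (by simp), key (-1) (by simp), key Complex.I (by simp),
    key (-Complex.I) (by simp)] with t h1 h2 h3 h4
  simp at h1 h2 h3 h4
  have := Complex.norm_le_abs_re_add_abs_im (f t)
  have h5 : |(f t).re| ≤ ‖F‖ := abs_le.2 ⟨by linarith, h1⟩
  have h6 : |(f t).im| ≤ ‖F‖ := abs_le.2 ⟨by linarith, h4⟩
  linarith

/-- The complex measure `E ↦ ⟨F* ψ, P(E) ψ⟩` has density `f` with respect to the measure of `ψ`.
Integrating `g` against it gives `⟨F* ψ, G ψ⟩`. Polarization writes this complex measure as a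
combination of four positive ones. -/
theorem inner_apply_apply (hf : P.HasIntegral f F) (hg : P.HasIntegral g G) (ψ : H) :
    inner ℂ ψ (F (G ψ)) = ∫ t, f t * g t ∂(P.measure ψ) := by
  let φ := ContinuousLinearMap.adjoint F ψ
  -- `g` is bounded only almost everywhere, with a null set depending on the vector. Cutting it off
  -- on the fixed set `S` gives a bound everywhere and changes none of the integrals.
  let S : Set ℝ := {t | ‖g t‖ ≤ 2 * ‖G‖}
  have hS : MeasurableSet S := measurableSet_le hg.measurable.norm measurable_const
  let g' := S.indicator g
  have hg' (χ : H) : g' =ᵐ[P.measure χ] g := by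
    filter_upwards [hg.ae_norm_le χ] with t ht
    exact Set.indicator_of_mem (show t ∈ S from ht) g
  have hb (t : ℝ) : ‖g' t‖ ≤ 2 * ‖G‖ := by
    by_cases ht : t ∈ S
    · simp only [g', Set.indicator_of_mem ht]
      exact ht
    · simp [g', ht]
  have hE (E : Set ℝ) (hE : MeasurableSet E) : ∫ t in E, f t ∂(P.measure ψ) =
      ((P.measure (ψ + φ)).real E - (P.measure (ψ - φ)).real E +
        Complex.I * (P.measure (ψ + Complex.I • φ)).real E -
        Complex.I * (P.measure (ψ - Complex.I • φ)).real E) / 4 := by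
    have := inner_apply_polarization (P.proj E : H →ₗ[ℂ] H) ψ φ
    simp only [ContinuousLinearMap.coe_coe, P.inner_proj_self hE] at this
    rw [← hf.inner_apply_proj hE, ← ContinuousLinearMap.adjoint_inner_left, this]
    simp only [P.measureReal_apply _ hE]
  have h1 := integral_mul_eq_of_setIntegral_eq (hf.integrable ψ) hE
    (hg.measurable.indicator hS) hb
  have h2 (χ : H) : ∫ t, g' t ∂(P.measure χ) = inner ℂ χ (G χ) := by
    rw [hg.inner_apply, integral_congr_ae (hg' χ)]
  have h3 : ∫ t, f t * g t ∂(P.measure ψ) = ∫ t, g' t * f t ∂(P.measure ψ) := by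
    refine integral_congr_ae ?_
    filter_upwards [hg' ψ] with t ht
    rw [ht, mul_comm]
  rw [h3, h1, h2, h2, h2, h2, ← ContinuousLinearMap.adjoint_inner_left]
  exact inner_apply_polarization (G : H →ₗ[ℂ] H) ψ φ

theorem mul (hf : P.HasIntegral f F) (hg : P.HasIntegral g G) :
    P.HasIntegral (fun t => f t * g t) (F.comp G) where
  measurable := hf.measurable.mul hg.measurable
  integrable ψ := (hg.integrable ψ).bdd_mul hf.measurable.aestronglyMeasurable (hf.ae_norm_le ψ)
  inner_apply := hf.inner_apply_apply hg

theorem conj (hf : P.HasIntegral f F) :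
    P.HasIntegral (fun t => starRingEnd ℂ (f t)) (ContinuousLinearMap.adjoint F) where
  measurable := Complex.continuous_conj.measurable.comp hf.measurable
  integrable ψ := Complex.conjLIE.toContinuousLinearEquiv.toContinuousLinearMap.integrable_comp
    (hf.integrable ψ)
  inner_apply ψ := by
    rw [ContinuousLinearMap.adjoint_inner_right, integral_conj, ← hf.inner_apply, inner_conj_symm]

theorem pow (hf : P.HasIntegral f F) (k : ℕ) : P.HasIntegral (fun t => f t ^ k) (F ^ k) := by
  induction k with
  | zero =>
    refine ⟨by simp, fun ψ => by simp, fun ψ => ?_⟩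
    simp only [pow_zero, integral_const, P.measureReal_univ]
    simp [inner_self_eq_norm_sq_to_K]
  | succ k ih =>
    simp only [pow_succ]
    exact ih.mul hf

theorem inner_apply_apply' (hf : P.HasIntegral f F) (hg : P.HasIntegral g G) (ψ : H) :
    inner ℂ (F ψ) (G ψ) = ∫ t, starRingEnd ℂ (f t) * g t ∂(P.measure ψ) := by
  rw [← hf.conj.inner_apply_apply hg, ContinuousLinearMap.adjoint_inner_right]

theorem norm_sq_apply (hf : P.HasIntegral f F) (ψ : H) :
    ‖F ψ‖ ^ 2 = ∫ t, ‖f t‖ ^ 2 ∂(P.measure ψ) := by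
  have := hf.inner_apply_apply' hf ψ
  simp only [inner_self_eq_norm_sq_to_K, Complex.conj_mul'] at this
  have h2 : ∫ t, ((‖f t‖ : ℂ) ^ 2) ∂(P.measure ψ) =
      ((∫ t, ‖f t‖ ^ 2 ∂(P.measure ψ) : ℝ) : ℂ) := by
    rw [← integral_complex_ofReal]
    simp
  rw [h2] at this
  exact Complex.ofReal_injective (by simpa using this)

end HasIntegral

end ProjectionValuedMeasure

/-! ### Spectral measures of a represented operator and of its resolvent. -/

namespace ProjectionValuedMeasure.Represents

open UnboundedOp

variable {H : Type*} [NormedAddCommGroup H] [InnerProductSpace ℂ H] [CompleteSpace H]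
  {P : ProjectionValuedMeasure H} {A : H →ₗ.[ℂ] H}

theorem proj_mem_domain (h : P.Represents A) {E : Set ℝ} (hE : MeasurableSet E) {ψ : H}
    (hψ : ψ ∈ A.domain) : P.proj E ψ ∈ A.domain := by
  rw [h.mem_domain_iff] at hψ ⊢
  rw [P.measure_proj hE]
  exact (setLIntegral_le_lintegral _ _).trans_lt hψ

theorem proj_Icc_mem_domain (h : P.Represents A) (r : ℝ) (ψ : H) :
    P.proj (Set.Icc (-r) r) ψ ∈ A.domain := by
  rw [h.mem_domain_iff, P.measure_proj measurableSet_Icc]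
  refine (setLIntegral_mono (g := fun _ => ENNReal.ofReal (r ^ 2)) measurable_const
    fun t ht => ENNReal.ofReal_le_ofReal (sq_le_sq' ht.1 ht.2)).trans_lt ?_
  rw [setLIntegral_const]
  exact ENNReal.mul_lt_top ENNReal.ofReal_lt_top (measure_lt_top _ _)

theorem symmetric (h : P.Represents A) (φ ψ : A.domain) :
    inner ℂ (A φ) (ψ : H) = inner ℂ (φ : H) (A ψ) := by
  have hr (χ : A.domain) : inner ℂ (A χ) (χ : H) = inner ℂ (χ : H) (A χ) := by
    rw [← inner_conj_symm, h.inner_apply, Complex.conj_ofReal]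
  have h1 := hr (φ + ψ)
  have h2 := hr (φ + Complex.I • ψ)
  simp only [Submodule.coe_add, Submodule.coe_smul, LinearPMap.map_add, LinearPMap.map_smul,
    inner_add_left, inner_add_right, inner_smul_left, inner_smul_right, Complex.conj_I, hr] at h1 h2
  linear_combination (1 / 2 : ℂ) * h1 - (1 / 2 : ℂ) * Complex.I * h2 + (1 / 2 : ℂ) *
    (inner ℂ (A φ) (ψ : H) - inner ℂ (A ψ) (φ : H) - inner ℂ (φ : H) (A ψ) +
      inner ℂ (ψ : H) (A φ)) * Complex.I_sq

/-- Only the quadratic form of `A` is prescribed, but it is determined by spectral measures. Hence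
`P(E) A P(Eᶜ)` has no matrix elements against the dense domain and vanishes. -/
theorem proj_comm (h : P.Represents A) (hA : Dense (A.domain : Set H)) {E : Set ℝ}
    (hE : MeasurableSet E) (ψ : A.domain) :
    P.proj E (A ψ) = A ⟨P.proj E ψ, h.proj_mem_domain hE ψ.2⟩ := by
  have key {E : Set ℝ} (hE : MeasurableSet E) :
      P.proj E (A ⟨P.proj Eᶜ ψ, h.proj_mem_domain hE.compl ψ.2⟩) = 0 := by
    refine hA.eq_zero_of_inner_right ℂ fun φ hφ => ?_
    rw [← P.inner_proj_left hE]
    exact (P.inner_eq_zero_of_measure_determined A.toFun (fun ψ φ e => by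
      change inner ℂ (ψ : H) (A ψ) = inner ℂ (φ : H) (A φ)
      rw [h.inner_apply, h.inner_apply, e]) hE
      (x := ⟨P.proj E φ, h.proj_mem_domain hE hφ⟩)
      (y := ⟨P.proj Eᶜ ψ, h.proj_mem_domain hE.compl ψ.2⟩) (P.proj_proj_self hE φ)
      (P.proj_proj_of_disjoint hE hE.compl disjoint_compl_right _)).1
  have h1 := key hE
  have h2 := key hE.compl
  have hs : ψ = ⟨P.proj E ψ, h.proj_mem_domain hE ψ.2⟩ +
      ⟨P.proj Eᶜ ψ, h.proj_mem_domain hE.compl ψ.2⟩ :=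
    Subtype.ext (P.proj_add_proj_compl hE (ψ : H)).symm
  simp only [compl_compl] at h2
  have h3 := P.proj_add_proj_compl hE (A ⟨P.proj E ψ, h.proj_mem_domain hE ψ.2⟩)
  rw [h2, add_zero] at h3
  conv_lhs => rw [hs]
  rw [LinearPMap.map_add, map_add, h1, add_zero, h3]

/-- The bounded operator `A P([-r, r])`. -/
theorem exists_truncation (h : P.Represents A) (hA : Dense (A.domain : Set H)) (r : ℝ) :
    ∃ B : H →L[ℂ] H, (∀ ψ, B ψ = A ⟨_, h.proj_Icc_mem_domain r ψ⟩) ∧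
      P.HasIntegral ((Set.Icc (-r) r).indicator fun t => (t : ℂ)) B := by
  let B : H →ₗ[ℂ] H := A.toFun.comp ((P.proj (Set.Icc (-r) r)).toLinearMap.codRestrict A.domain
    (h.proj_Icc_mem_domain r))
  have hBA (ψ : H) : B ψ = A ⟨_, h.proj_Icc_mem_domain r ψ⟩ := rfl
  have hPB (ψ : H) : P.proj (Set.Icc (-r) r) (B ψ) = B ψ := by
    rw [hBA, h.proj_comm hA measurableSet_Icc]
    congr 1
    exact Subtype.ext (P.proj_proj_self measurableSet_Icc ψ)
  have hB : B.IsSymmetric := fun φ ψ => by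
    rw [← hPB φ, P.inner_proj_left measurableSet_Icc, ← hPB ψ,
      ← P.inner_proj_left measurableSet_Icc φ]
    exact h.symmetric ⟨_, h.proj_Icc_mem_domain r φ⟩ ⟨_, h.proj_Icc_mem_domain r ψ⟩
  -- Boundedness is the Hellinger–Toeplitz theorem: `B` is symmetric and everywhere defined.
  refine ⟨⟨B, hB.continuous⟩, hBA, Complex.measurable_ofReal.indicator measurableSet_Icc,
    fun ψ => ?_, fun ψ => ?_⟩
  · refine Integrable.of_bound
      (Complex.measurable_ofReal.indicator measurableSet_Icc).aestronglyMeasurable |r|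
      (Eventually.of_forall fun t => ?_)
    by_cases ht : t ∈ Set.Icc (-r) r
    · rw [Set.indicator_of_mem ht, Complex.norm_real]
      exact abs_le_abs ht.2 (by linarith [ht.1])
    · rw [Set.indicator_of_notMem ht, norm_zero]
      exact abs_nonneg r
  · change inner ℂ ψ (B ψ) = _
    rw [← hPB ψ, ← P.inner_proj_left measurableSet_Icc, integral_indicator measurableSet_Icc]
    refine (h.inner_apply ⟨_, h.proj_Icc_mem_domain r ψ⟩).trans ?_
    rw [P.measure_proj measurableSet_Icc, integral_complex_ofReal]

theorem integrable_sq (h : P.Represents A) {ψ : H} (hψ : ψ ∈ A.domain) :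
    Integrable (fun t => t ^ 2) (P.measure ψ) :=
  (lintegral_ofReal_ne_top_iff_integrable (measurable_id.pow_const 2).aestronglyMeasurable
    (Eventually.of_forall fun t => sq_nonneg t)).1 ((h.mem_domain_iff ψ).1 hψ).ne

theorem integrable_id (h : P.Represents A) {ψ : H} (hψ : ψ ∈ A.domain) :
    Integrable (fun t => t) (P.measure ψ) := by
  refine ((integrable_const (1 : ℝ)).add (h.integrable_sq hψ)).mono'
    measurable_id.aestronglyMeasurable (Eventually.of_forall fun t => ?_)
  simp only [Real.norm_eq_abs, Pi.add_apply]
  exact abs_le.2 ⟨by nlinarith, by nlinarith⟩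

/-- The identity holds after truncation to `[-n, n]`, where `A` acts as a bounded operator with a
known integral; then both sides pass to the limit along these increasing intervals. -/
theorem norm_sq_apply (h : P.Represents A) (hA : Dense (A.domain : Set H)) (ψ : A.domain) :
    ‖A ψ‖ ^ 2 = ∫ t, t ^ 2 ∂(P.measure (ψ : H)) := by
  have h1 (n : ℕ) : (P.measure (A ψ)).real (Set.Icc (-(n : ℝ)) n) =
      ∫ t in Set.Icc (-(n : ℝ)) n, t ^ 2 ∂(P.measure (ψ : H)) := by
    obtain ⟨B, hB, hi⟩ := h.exists_truncation hA n
    rw [P.measureReal_apply _ measurableSet_Icc, h.proj_comm hA measurableSet_Icc, ← hB,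
      hi.norm_sq_apply, ← integral_indicator measurableSet_Icc]
    congr 1 with t
    by_cases ht : t ∈ Set.Icc (-(n : ℝ)) n <;> simp [ht]
  have hmono : Monotone fun n : ℕ => Set.Icc (-(n : ℝ)) n := fun m n hmn =>
    Set.Icc_subset_Icc (by simpa using hmn) (by simpa using hmn)
  have hU : ⋃ n : ℕ, Set.Icc (-(n : ℝ)) n = Set.univ := by
    refine Set.eq_univ_of_forall fun t => ?_
    obtain ⟨n, hn⟩ := exists_nat_ge |t|
    exact Set.mem_iUnion.2 ⟨n, abs_le.1 hn⟩
  have h2 : Tendsto (fun n : ℕ => (P.measure (A ψ)).real (Set.Icc (-(n : ℝ)) n)) atTop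
      (𝓝 (‖A ψ‖ ^ 2)) := by
    rw [← P.measureReal_univ, ← hU]
    exact (ENNReal.tendsto_toReal (measure_ne_top _ _)).comp (tendsto_measure_iUnion_atTop hmono)
  have h3 := tendsto_setIntegral_of_monotone (μ := P.measure (ψ : H)) (f := fun t => t ^ 2)
    (fun n => measurableSet_Icc) hmono (h.integrable_sq ψ.2).integrableOn
  rw [hU, Measure.restrict_univ] at h3
  simp only [← h1] at h3
  exact tendsto_nhds_unique h2 h3

theorem norm_sq_sub_smul (h : P.Represents A) (hA : Dense (A.domain : Set H)) (z : ℂ)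
    (ψ : A.domain) :
    ‖A ψ - z • (ψ : H)‖ ^ 2 = ∫ t, ‖(t : ℂ) - z‖ ^ 2 ∂(P.measure (ψ : H)) := by
  have h1 : (fun t : ℝ => ‖(t : ℂ) - z‖ ^ 2) = fun t => t ^ 2 - 2 * z.re * t + ‖z‖ ^ 2 * 1 := by
    ext t
    rw [← Complex.normSq_eq_norm_sq, ← Complex.normSq_eq_norm_sq, Complex.normSq_apply,
      Complex.normSq_apply]
    simp
    ring
  have h2 : RCLike.re (inner ℂ (A ψ) (z • (ψ : H))) =
      z.re * ∫ t, t ∂(P.measure (ψ : H)) := by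
    rw [inner_smul_right, h.symmetric, h.inner_apply]
    simp
  have h3 := (h.integrable_sq ψ.2).sub ((h.integrable_id ψ.2).const_mul (2 * z.re))
  rw [h1, integral_add (f := fun t => t ^ 2 - 2 * z.re * t) h3 (integrable_const _), integral_sub (h.integrable_sq ψ.2) ((h.integrable_id ψ.2).const_mul _),
    integral_const_mul, integral_const, P.measureReal_univ, ← h.norm_sq_apply hA ψ,
    @norm_sub_sq ℂ, h2, norm_smul]
  simp only [smul_eq_mul]
  ring

/-- The norm identity for `A - z` is applied to `P(E) ψ`, which stays in the domain and commutes
with `A`. -/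
theorem measure_sub_smul (h : P.Represents A) (hA : Dense (A.domain : Set H)) (z : ℂ)
    (ψ : A.domain) : P.measure (A ψ - z • (ψ : H)) =
      (P.measure (ψ : H)).withDensity fun t => ENNReal.ofReal (‖(t : ℂ) - z‖ ^ 2) := by
  have hm : Measurable fun t : ℝ => ‖(t : ℂ) - z‖ ^ 2 := by fun_prop
  ext E hE
  rw [withDensity_apply _ hE, P.measure_apply _ hE, map_sub, h.proj_comm hA hE, map_smul,
    h.norm_sq_sub_smul hA z ⟨P.proj E ψ, h.proj_mem_domain hE ψ.2⟩, ← P.measure_proj hE]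
  refine ofReal_integral_eq_lintegral_ofReal ?_ (Eventually.of_forall fun t => by positivity)
  have hd := h.proj_mem_domain hE ψ.2
  refine (((h.integrable_sq hd).const_mul 2).add (integrable_const (2 * ‖z‖ ^ 2))).mono'
    hm.aestronglyMeasurable (Eventually.of_forall fun t => ?_)
  have := norm_sub_le (t : ℂ) z
  rw [Complex.norm_real, Real.norm_eq_abs] at this
  simp only [Pi.add_apply, norm_pow, norm_norm]
  rw [← sq_abs t]
  nlinarith [norm_nonneg ((t : ℂ) - z), sq_nonneg (|t| - ‖z‖)]

/-- With `ψ = (A - z) φ`, the measure of `ψ` is `|t - z|²` times that of `φ`. The integral of `(t -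
z)⁻¹` therefore becomes that of `t - z̄` against the measure of `φ`, which equals `⟨(A - z) φ, φ⟩`.
-/
theorem hasIntegral_resolvent (h : P.Represents A) (hA : Dense (A.domain : Set H)) {z : ℂ}
    {R : H →L[ℂ] H} (hR : IsResolventAt A z R) :
    P.HasIntegral (fun t => ((t : ℂ) - z)⁻¹) R := by
  have hm : Measurable fun t : ℝ => ENNReal.ofReal (‖(t : ℂ) - z‖ ^ 2) := by fun_prop
  have hw (t : ℝ) : (ENNReal.ofReal (‖(t : ℂ) - z‖ ^ 2)).toReal • ((t : ℂ) - z)⁻¹ =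
      (t : ℂ) - starRingEnd ℂ z := by
    rw [ENNReal.toReal_ofReal (by positivity), Complex.real_smul]
    -- At `t = z` the left side is `0` because `0⁻¹ = 0`, and the right side is `0` because `z` is
    -- then real.
    by_cases ht : (t : ℂ) - z = 0
    · have : starRingEnd ℂ z = t := by rw [← sub_eq_zero.1 ht, Complex.conj_ofReal]
      rw [ht, this]
      simp
    · have : ((‖(t : ℂ) - z‖ ^ 2 : ℝ) : ℂ) = ((t : ℂ) - z) * starRingEnd ℂ ((t : ℂ) - z) := by
        rw [Complex.mul_conj']
        push_cast
        rfl
      rw [this, mul_right_comm, mul_inv_cancel₀ ht, one_mul, map_sub, Complex.conj_ofReal]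
  refine ⟨by fun_prop, fun ψ => ?_, fun ψ => ?_⟩
  all_goals
    obtain ⟨φ, hφ, hψ⟩ := hR.2 ψ
    have hμ := h.measure_sub_smul hA z φ
    rw [hψ] at hμ
    rw [hμ]
  · rw [integrable_withDensity_iff_integrable_smul' hm
      (Eventually.of_forall fun t => ENNReal.ofReal_lt_top)]
    simp only [hw]
    exact (h.integrable_id φ.2).ofReal.sub (integrable_const _)
  · rw [integral_withDensity_eq_integral_toReal_smul hm
      (Eventually.of_forall fun t => ENNReal.ofReal_lt_top)]
    simp only [hw]
    rw [integral_sub (h.integrable_id φ.2).ofReal (integrable_const _), integral_const,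
      integral_complex_ofReal, ← h.inner_apply, P.measureReal_univ, ← hφ, ← hψ, inner_sub_left,
      inner_smul_left, h.symmetric, inner_self_eq_norm_sq_to_K]
    simp [mul_comm]

end ProjectionValuedMeasure.Represents

/-! ### Portmanteau for finite measures, and the support of spectral measures. -/

/-- Normalizing reduces this to probability measures. A zero limit cannot be normalized, but then
the total masses already tend to `0`. -/
theorem MeasureTheory.FiniteMeasure.tendsto_apply_of_null_frontier {Ω ι : Type*} {L : Filter ι}
    [MeasurableSpace Ω] [TopologicalSpace Ω] [OpensMeasurableSpace Ω] [HasOuterApproxClosed Ω]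
    [Nonempty Ω] {μ : FiniteMeasure Ω} {μs : ι → FiniteMeasure Ω} (h : Tendsto μs L (𝓝 μ))
    {E : Set Ω} (hE : μ (frontier E) = 0) : Tendsto (fun i => μs i E) L (𝓝 (μ E)) := by
  have hm : Tendsto (fun i => (μs i).mass) L (𝓝 μ.mass) := (FiniteMeasure.continuous_mass.tendsto _).comp h
  by_cases h0 : μ = 0
  · subst h0
    rw [FiniteMeasure.zero_mass] at hm
    exact tendsto_of_tendsto_of_tendsto_of_le_of_le tendsto_const_nhds hm (fun _ => zero_le)
      (fun i => FiniteMeasure.apply_le_mass _ _)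
  · have hn := FiniteMeasure.tendsto_normalize_of_tendsto h h0
    simp only [FiniteMeasure.self_eq_mass_mul_normalize]
    refine hm.mul (ProbabilityMeasure.tendsto_measure_of_null_frontier_of_tendsto hn ?_)
    have := μ.self_eq_mass_mul_normalize (frontier E)
    rw [hE, eq_comm, mul_eq_zero] at this
    exact this.resolve_left (μ.mass_nonzero_iff.2 h0)

namespace ProjectionValuedMeasure.Represents

open UnboundedOp

variable {H : Type*} [NormedAddCommGroup H] [InnerProductSpace ℂ H] [CompleteSpace H]
  {P : ProjectionValuedMeasure H} {A : H →ₗ.[ℂ] H}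

/-- Every vector is some `(A - z) φ`, whose measure has a density vanishing at `z`. -/
theorem ae_ne_of_mem_resolventSet (h : P.Represents A) (hA : Dense (A.domain : Set H)) {z : ℂ}
    (hz : z ∈ resolventSet A) (ψ : H) : ∀ᵐ (t : ℝ) ∂(P.measure ψ), (t : ℂ) ≠ z := by
  obtain ⟨R, hR⟩ := hz
  obtain ⟨φ, -, hψ⟩ := hR.2 ψ
  have hμ := h.measure_sub_smul hA z φ
  rw [hψ] at hμ
  have hm : MeasurableSet {t : ℝ | (t : ℂ) = z} :=
    measurableSet_eq_fun Complex.measurable_ofReal measurable_const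
  simp only [ae_iff, not_not, hμ]
  rw [withDensity_apply _ hm]
  refine setLIntegral_eq_zero hm fun t ht => ?_
  simp [show (t : ℂ) = z from ht]

/-- If `s` is in the resolvent set with resolvent `R`, then `|t - s|⁻¹ ≤ 2 ‖R‖` almost everywhere,
so a neighbourhood of `s` is null. A locally null set is null. -/
theorem ae_mem_spectrum (h : P.Represents A) (hA : Dense (A.domain : Set H)) (ψ : H) :
    ∀ᵐ (t : ℝ) ∂(P.measure ψ), (t : ℂ) ∈ UnboundedOp.spectrum A := by
  rw [ae_iff]
  refine measure_null_of_locally_null _ fun s hs => ?_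
  have hs' : (s : ℂ) ∈ resolventSet A := not_not.1 hs
  obtain ⟨R, hR⟩ := id hs'
  refine ⟨{t | |t - s| < (2 * ‖R‖ + 1)⁻¹}, mem_nhdsWithin_of_mem_nhds
    (Metric.ball_mem_nhds s (by positivity)), ?_⟩
  refine measure_mono_null (t := {t | ¬ ((t : ℂ) ≠ s ∧ ‖((t : ℂ) - s)⁻¹‖ ≤ 2 * ‖R‖)}) ?_
    (ae_iff.1 ((h.ae_ne_of_mem_resolventSet hA hs' ψ).and
      ((h.hasIntegral_resolvent hA hR).ae_norm_le ψ)))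
  rintro t ht ⟨h1, h2⟩
  have h3 : 0 < |t - s| := abs_pos.2 (sub_ne_zero.2 fun e => h1 (by rw [e]))
  rw [← Complex.ofReal_sub, norm_inv, Complex.norm_real, Real.norm_eq_abs] at h2
  have h4 := (inv_lt_inv₀ (by positivity) h3).2 (show |t - s| < (2 * ‖R‖ + 1)⁻¹ from ht)
  rw [inv_inv] at h4
  linarith

theorem ae_norm_inv_le (h : P.Represents A) (hA : Dense (A.domain : Set H)) {z : ℂ} {d : ℝ}
    (hd : 0 < d) (hz : ∀ w ∈ UnboundedOp.spectrum A, d ≤ ‖w - z‖) (ψ : H) :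
    ∀ᵐ (t : ℝ) ∂(P.measure ψ), ‖((t : ℂ) - z)⁻¹‖ ≤ d⁻¹ := by
  filter_upwards [h.ae_mem_spectrum hA ψ] with t ht
  rw [norm_inv]
  exact inv_anti₀ hd (hz _ ht)

end ProjectionValuedMeasure.Represents

theorem ProjectionValuedMeasure.HasIntegral.norm_apply_le {H : Type*} [NormedAddCommGroup H]
    [InnerProductSpace ℂ H] [CompleteSpace H] {P : ProjectionValuedMeasure H} {f : ℝ → ℂ}
    {F : H →L[ℂ] H} (h : P.HasIntegral f F) {C : ℝ} (hC : 0 ≤ C) (ψ : H)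
    (hb : ∀ᵐ t ∂(P.measure ψ), ‖f t‖ ≤ C) : ‖F ψ‖ ≤ C * ‖ψ‖ := by
  refine le_of_sq_le_sq ?_ (by positivity)
  rw [h.norm_sq_apply, mul_pow, ← P.measureReal_univ, mul_comm, ← smul_eq_mul, ← integral_const]
  refine integral_mono_of_nonneg (Eventually.of_forall fun t => by positivity)
    (integrable_const _) ?_
  filter_upwards [hb] with t ht
  gcongr

/-! ### Weak convergence of the transported spectral measures. -/

namespace ProjectionValuedMeasure

variable {K : Type*} [NormedAddCommGroup K] [InnerProductSpace ℂ K] [CompleteSpace K]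
  (Q : ProjectionValuedMeasure K) {C : ℝ} {q : ℝ → Metric.closedBall (0 : ℂ) C}

variable {Q} in
-- Moments of the transported measure are inner products of powers of the resolvent; this is where
-- operator convergence enters the measures.
theorem HasIntegral.integral_monomial_comp {f : ℝ → ℂ} {F : K →L[ℂ] K} (hF : Q.HasIntegral f F)
    {x : K} (hx : ∀ᵐ t ∂(Q.measure x), (q t : ℂ) = f t) {j k : ℕ} :
    ∫ t, ((ContinuousMap.restrict _ (.id ℂ) : C(Metric.closedBall (0 : ℂ) C, ℂ)) ^ j *
      star (ContinuousMap.restrict _ (.id ℂ) : C(Metric.closedBall (0 : ℂ) C, ℂ)) ^ k) (q t)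
        ∂(Q.measure x) = inner ℂ ((F ^ k) x) ((F ^ j) x) := by
  rw [(hF.pow k).inner_apply_apply' (hF.pow j)]
  refine integral_congr_ae ?_
  filter_upwards [hx] with t ht
  simp [ht, mul_comm]

theorem integrable_comp (hq : Measurable q) [CompactSpace (Metric.closedBall (0 : ℂ) C)]
    (μ : Measure ℝ) [IsFiniteMeasure μ] (g : C(Metric.closedBall (0 : ℂ) C, ℂ)) :
    Integrable (fun t => g (q t)) μ :=
  Integrable.of_bound (g.continuous.measurable.comp hq).aestronglyMeasurable ‖g‖
    (Eventually.of_forall fun _ => g.norm_coe_le_norm _)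

theorem dist_integral_comp_lt (hq : Measurable q) [CompactSpace (Metric.closedBall (0 : ℂ) C)]
    {g p : C(Metric.closedBall (0 : ℂ) C, ℂ)} {ε M : ℝ} (hgp : dist g p < ε / (M ^ 2 + 1))
    {x : K} (hx : ‖x‖ ≤ M) :
    dist (∫ t, g (q t) ∂(Q.measure x)) (∫ t, p (q t) ∂(Q.measure x)) < ε := by
  have hε : 0 < ε := by
    have := dist_nonneg.trans_lt hgp
    rwa [lt_div_iff₀ (by positivity), zero_mul] at this
  rw [dist_eq_norm, ← integral_sub (integrable_comp hq _ g) (integrable_comp hq _ p)]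
  refine (norm_integral_le_of_norm_le_const (C := ε / (M ^ 2 + 1))
    (Eventually.of_forall fun t => ?_)).trans_lt ?_
  · rw [← dist_eq_norm]
    exact (ContinuousMap.dist_apply_le_dist _).trans hgp.le
  · rw [Q.measureReal_univ]
    have : ‖x‖ ^ 2 ≤ M ^ 2 := by gcongr
    rw [div_mul_eq_mul_div, div_lt_iff₀ (by positivity)]
    nlinarith

end ProjectionValuedMeasure

section WeakConvergence

variable {H : Type*} [NormedAddCommGroup H] [InnerProductSpace ℂ H] [CompleteSpace H]
  {Hn : ℕ → Type*} [∀ n, NormedAddCommGroup (Hn n)] [∀ n, InnerProductSpace ℂ (Hn n)]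
  [∀ n, CompleteSpace (Hn n)] {J : ∀ n, H →L[ℂ] Hn n}

theorem tendsto_inner_map_map
    (hJ : ∀ ψ : H, Tendsto (fun n => ContinuousLinearMap.adjoint (J n) (J n ψ)) atTop (𝓝 ψ))
    (φ ψ : H) : Tendsto (fun n => inner ℂ (J n φ) (J n ψ)) atTop (𝓝 (inner ℂ φ ψ)) := by
  simp only [← ContinuousLinearMap.adjoint_inner_right]
  exact tendsto_const_nhds.inner (hJ ψ)

theorem tendsto_norm_map
    (hJ : ∀ ψ : H, Tendsto (fun n => ContinuousLinearMap.adjoint (J n) (J n ψ)) atTop (𝓝 ψ))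
    (ψ : H) : Tendsto (fun n => ‖J n ψ‖) atTop (𝓝 ‖ψ‖) := by
  have h := (tendsto_inner_map_map hJ ψ ψ).norm.sqrt
  simpa [inner_self_eq_norm_sq_to_K] using h

theorem tendsto_norm_of_tendsto_norm_sub
    (hJ : ∀ ψ : H, Tendsto (fun n => ContinuousLinearMap.adjoint (J n) (J n ψ)) atTop (𝓝 ψ))
    {x : ∀ n, Hn n} {φ : H} (hx : Tendsto (fun n => ‖x n - J n φ‖) atTop (𝓝 0)) :
    Tendsto (fun n => ‖x n‖) atTop (𝓝 ‖φ‖) := by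
  have h : Tendsto (fun n => ‖x n‖ - ‖J n φ‖) atTop (𝓝 0) :=
    squeeze_zero_norm (fun n => abs_norm_sub_norm_le _ _) hx
  simpa using h.add (tendsto_norm_map hJ φ)

theorem tendsto_inner_of_tendsto_norm_sub
    (hJ : ∀ ψ : H, Tendsto (fun n => ContinuousLinearMap.adjoint (J n) (J n ψ)) atTop (𝓝 ψ))
    {x y : ∀ n, Hn n} {φ ψ : H} (hx : Tendsto (fun n => ‖x n - J n φ‖) atTop (𝓝 0))
    (hy : Tendsto (fun n => ‖y n - J n ψ‖) atTop (𝓝 0)) :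
    Tendsto (fun n => inner ℂ (x n) (y n)) atTop (𝓝 (inner ℂ φ ψ)) := by
  have h1 : Tendsto (fun n => inner ℂ (x n - J n φ) (y n)) atTop (𝓝 0) := by
    refine squeeze_zero_norm (fun n => norm_inner_le_norm _ _) ?_
    simpa using hx.mul (tendsto_norm_of_tendsto_norm_sub hJ hy)
  have h2 : Tendsto (fun n => inner ℂ (J n φ) (y n - J n ψ)) atTop (𝓝 0) := by
    refine squeeze_zero_norm (fun n => norm_inner_le_norm _ _) ?_
    simpa using (tendsto_norm_map hJ φ).mul hy
  have h3 := (h1.add h2).add (tendsto_inner_map_map hJ φ ψ)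
  simp only [zero_add] at h3
  refine h3.congr fun n => ?_
  rw [inner_sub_left, inner_sub_right]
  ring

omit [CompleteSpace H] [∀ n, CompleteSpace (Hn n)] in
theorem tendsto_norm_pow_sub {T : H →L[ℂ] H} {Tn : ∀ n, Hn n →L[ℂ] Hn n} {C : ℝ}
    (hC : ∀ n x, ‖Tn n x‖ ≤ C * ‖x‖)
    (hT : ∀ ψ : H, Tendsto (fun n => ‖Tn n (J n ψ) - J n (T ψ)‖) atTop (𝓝 0)) (k : ℕ) (ψ : H) :
    Tendsto (fun n => ‖(Tn n ^ k) (J n ψ) - J n ((T ^ k) ψ)‖) atTop (𝓝 0) := by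
  induction k with
  | zero => simp
  | succ k ih =>
    have h0 := (ih.const_mul C).add (hT ((T ^ k) ψ))
    rw [mul_zero, add_zero] at h0
    refine squeeze_zero (fun n => norm_nonneg _) (fun n => ?_) h0
    have : (Tn n ^ (k + 1)) (J n ψ) - J n ((T ^ (k + 1)) ψ) =
        Tn n ((Tn n ^ k) (J n ψ) - J n ((T ^ k) ψ)) +
          (Tn n (J n ((T ^ k) ψ)) - J n (T ((T ^ k) ψ))) := by
      rw [pow_succ', pow_succ', map_sub, mul_apply_eq_comp, mul_apply_eq_comp]
      abel
    rw [this]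
    exact (norm_add_le _ _).trans (add_le_add (hC n _) le_rfl)

variable {P : ProjectionValuedMeasure H} {Pn : ∀ n, ProjectionValuedMeasure (Hn n)}
  {f : ℝ → ℂ} {T : H →L[ℂ] H} {Tn : ∀ n, Hn n →L[ℂ] Hn n} {C : ℝ}

theorem tendsto_integral_comp
    (hJ : ∀ ψ : H, Tendsto (fun n => ContinuousLinearMap.adjoint (J n) (J n ψ)) atTop (𝓝 ψ))
    (h : P.HasIntegral f T) (hn : ∀ n, (Pn n).HasIntegral f (Tn n))
    {q : ℝ → Metric.closedBall (0 : ℂ) C} (hq : Measurable q)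
    (hqf : ∀ ψ, ∀ᵐ t ∂(P.measure ψ), (q t : ℂ) = f t)
    (hqfn : ∀ n x, ∀ᵐ t ∂((Pn n).measure x), (q t : ℂ) = f t)
    (hT : ∀ ψ : H, Tendsto (fun n => ‖Tn n (J n ψ) - J n (T ψ)‖) atTop (𝓝 0))
    (g : C(Metric.closedBall (0 : ℂ) C, ℂ)) (ψ : H) :
    Tendsto (fun n => ∫ t, g (q t) ∂((Pn n).measure (J n ψ))) atTop
      (𝓝 (∫ t, g (q t) ∂(P.measure ψ))) := by
  have : CompactSpace (Metric.closedBall (0 : ℂ) C) :=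
    isCompact_iff_compactSpace.1 (isCompact_closedBall _ _)
  have hC0 : 0 ≤ C := (norm_nonneg _).trans (mem_closedBall_zero_iff.1 (q 0).2)
  have hCn (n : ℕ) (x : Hn n) : ‖Tn n x‖ ≤ C * ‖x‖ := by
    refine (hn n).norm_apply_le hC0 x ?_
    filter_upwards [hqfn n x] with t ht
    rw [← ht]
    exact mem_closedBall_zero_iff.1 (q t).2
  have hgi (μ : Measure ℝ) [IsFiniteMeasure μ] (g : C(Metric.closedBall (0 : ℂ) C, ℂ)) :=
    ProjectionValuedMeasure.integrable_comp hq μ g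
  -- The test functions with convergent integrals form a subspace. It contains all monomials in `w`
  -- and its conjugate, hence the star algebra generated by the coordinate function.
  let S : Submodule ℂ C(Metric.closedBall (0 : ℂ) C, ℂ) :=
    { carrier := {g | Tendsto (fun n => ∫ t, g (q t) ∂((Pn n).measure (J n ψ))) atTop
        (𝓝 (∫ t, g (q t) ∂(P.measure ψ)))}
      zero_mem' := by simp
      add_mem' := fun {g₁ g₂} h₁ h₂ => by
        simp only [Set.mem_ofPred_eq, ContinuousMap.add_apply] at h₁ h₂ ⊢
        simp only [integral_add (hgi _ g₁) (hgi _ g₂)]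
        exact h₁.add h₂
      smul_mem' := fun c g hg => by
        simp only [Set.mem_ofPred_eq, ContinuousMap.smul_apply, integral_smul] at hg ⊢
        exact hg.const_smul c }
  have hS : ∀ g ∈ S, Tendsto (fun n => ∫ t, g (q t) ∂((Pn n).measure (J n ψ))) atTop
        (𝓝 (∫ t, g (q t) ∂(P.measure ψ))) := fun g hg => hg
  let X : C(Metric.closedBall (0 : ℂ) C, ℂ) := ContinuousMap.restrict _ (.id ℂ)
  have hmono (j k : ℕ) : X ^ j * star X ^ k ∈ S := by
    change Tendsto _ _ _
    rw [h.integral_monomial_comp (hqf ψ)]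
    refine Tendsto.congr (fun n => ((hn n).integral_monomial_comp (hqfn n (J n ψ))).symm) ?_
    exact tendsto_inner_of_tendsto_norm_sub hJ (tendsto_norm_pow_sub hCn hT k ψ)
      (tendsto_norm_pow_sub hCn hT j ψ)
  have hadj : ((StarAlgebra.adjoin ℂ {X}).toSubalgebra.toSubmodule : Submodule ℂ _) ≤ S := by
    rw [StarAlgebra.adjoin_eq_span, Submodule.span_le]
    intro p hp
    rw [Set.star_singleton, Set.singleton_union, SetLike.mem_coe, Submonoid.mem_closure_pair] at hp
    obtain ⟨j, k, rfl⟩ := hp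
    exact hmono j k
  -- Stone–Weierstrass on the disk; the conjugate is needed because the disk is a subset of `ℂ`.
  have hg : g ∈ closure ((StarAlgebra.adjoin ℂ {X} : StarSubalgebra ℂ _) : Set _) := by
    have : g ∈ StarAlgebra.elemental ℂ X := by
      rw [ContinuousMap.elemental_id_eq_top]
      trivial
    exact this
  rw [Metric.tendsto_atTop]
  intro ε hε
  obtain ⟨M, hM⟩ := (tendsto_norm_map hJ ψ).bddAbove_range
  have hM' (n : ℕ) : ‖J n ψ‖ ≤ M := hM ⟨n, rfl⟩
  have hψM : ‖ψ‖ ≤ M := le_of_tendsto' (tendsto_norm_map hJ ψ) hM'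
  -- All the measures have mass at most `M ^ 2`, so a uniform error below `ε / 3 / (M ^ 2 + 1)`
  -- costs less than `ε / 3` in each integral; the `+ 1` avoids division by zero.
  obtain ⟨p, hp, hgp⟩ := Metric.mem_closure_iff.1 hg (ε / 3 / (M ^ 2 + 1)) (by positivity)
  have hpS : p ∈ S := hadj hp
  obtain ⟨N, hN⟩ := Metric.tendsto_atTop.1 (hS p hpS) (ε / 3) (by positivity)
  refine ⟨N, fun n hn => ?_⟩
  have h1 := (Pn n).dist_integral_comp_lt hq hgp (hM' n)
  have h2 := P.dist_integral_comp_lt hq hgp hψM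
  have h3 := hN n hn
  rw [dist_comm] at h2
  refine (dist_triangle4 _ _ _ _).trans_lt ((add_lt_add (add_lt_add h1 h3) h2).trans_eq ?_)
  ring

end WeakConvergence

/-! ### From weak convergence of measures to strong convergence of operators. -/

section StrongConvergence

open UnboundedOp ProjectionValuedMeasure

variable {H : Type*} [NormedAddCommGroup H] [InnerProductSpace ℂ H] [CompleteSpace H]
  {Hn : ℕ → Type*} [∀ n, NormedAddCommGroup (Hn n)] [∀ n, InnerProductSpace ℂ (Hn n)]
  [∀ n, CompleteSpace (Hn n)] {J : ∀ n, H →L[ℂ] Hn n}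

theorem tendsto_norm_sub_of_tendsto_norm_sq
    (hJ : ∀ ψ : H, Tendsto (fun n => ContinuousLinearMap.adjoint (J n) (J n ψ)) atTop (𝓝 ψ))
    {x : ∀ n, Hn n} {φ : H} (h1 : Tendsto (fun n => ‖x n‖ ^ 2) atTop (𝓝 (‖φ‖ ^ 2)))
    (h2 : Tendsto (fun n => inner ℂ (J n φ) (x n)) atTop (𝓝 (inner ℂ φ φ))) :
    Tendsto (fun n => ‖x n - J n φ‖) atTop (𝓝 0) := by
  have h3 : Tendsto (fun n => ‖x n - J n φ‖ ^ 2) atTop (𝓝 0) := by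
    have h4 : Tendsto (fun n => ‖x n‖ ^ 2 - 2 * (inner ℂ (J n φ) (x n)).re + ‖J n φ‖ ^ 2) atTop
        (𝓝 (‖φ‖ ^ 2 - 2 * (inner ℂ φ φ).re + ‖φ‖ ^ 2)) :=
      (h1.sub (((Complex.continuous_re.tendsto _).comp h2).const_mul 2)).add
        ((tendsto_norm_map hJ φ).pow 2)
    have h5 : ‖φ‖ ^ 2 - 2 * (inner ℂ φ φ).re + ‖φ‖ ^ 2 = 0 := by
      have : (inner ℂ φ φ).re = ‖φ‖ ^ 2 := inner_self_eq_norm_sq (𝕜 := ℂ) φ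
      rw [this]
      ring
    rw [h5] at h4
    refine h4.congr fun n => ?_
    rw [@norm_sub_sq ℂ, inner_re_symm (x n)]
    rfl
  simpa using h3.sqrt

/-- The hypotheses `hQ` and `hQn` make the squared norms quadratic forms, so polarization yields
convergence of all matrix elements. Together with the norms this gives `Qn J n ψ - J n Q ψ → 0`, and
the bounded adjoints and `J* J → 1` finish. -/
theorem tendsto_adjoint_comp_of_tendsto_norm_sq {B : ℝ} (hB : ∀ n, ‖J n‖ ≤ B)
    (hJ : ∀ ψ : H, Tendsto (fun n => ContinuousLinearMap.adjoint (J n) (J n ψ)) atTop (𝓝 ψ))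
    {Q : H →L[ℂ] H} {Qn : ∀ n, Hn n →L[ℂ] Hn n}
    (hQ : ∀ ψ, inner ℂ ψ (Q ψ) = ((‖Q ψ‖ ^ 2 : ℝ) : ℂ))
    (hQn : ∀ n ψ, inner ℂ ψ (Qn n ψ) = ((‖Qn n ψ‖ ^ 2 : ℝ) : ℂ))
    (h : ∀ ψ, Tendsto (fun n => ‖Qn n (J n ψ)‖ ^ 2) atTop (𝓝 (‖Q ψ‖ ^ 2))) (ψ : H) :
    Tendsto (fun n => ContinuousLinearMap.adjoint (J n) (Qn n (J n ψ))) atTop (𝓝 (Q ψ)) := by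
  have hq (χ : H) : Tendsto (fun n => inner ℂ (J n χ) (Qn n (J n χ))) atTop
      (𝓝 (inner ℂ χ (Q χ))) := by
    simp only [hQ, hQn]
    exact (Complex.continuous_ofReal.tendsto _).comp (h χ)
  have hw (φ : H) : Tendsto (fun n => inner ℂ (J n φ) (Qn n (J n ψ))) atTop
      (𝓝 (inner ℂ φ (Q ψ))) := by
    have e1 := inner_apply_polarization (Q : H →ₗ[ℂ] H) ψ φ
    have e2 (n : ℕ) := inner_apply_polarization (Qn n : Hn n →ₗ[ℂ] Hn n) (J n ψ) (J n φ)
    simp only [ContinuousLinearMap.coe_coe, ← map_smul, ← map_add, ← map_sub] at e1 e2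
    rw [e1]
    simp only [e2]
    exact ((((hq _).sub (hq _)).add ((hq _).const_mul _)).sub ((hq _).const_mul _)).div_const _
  have hs : Tendsto (fun n => ‖Qn n (J n ψ) - J n (Q ψ)‖) atTop (𝓝 0) :=
    tendsto_norm_sub_of_tendsto_norm_sq hJ (h ψ) (hw (Q ψ))
  have hz : Tendsto (fun n => ContinuousLinearMap.adjoint (J n) (Qn n (J n ψ) - J n (Q ψ))) atTop
      (𝓝 0) := by
    have h0 := hs.const_mul B
    rw [mul_zero] at h0
    refine squeeze_zero_norm (fun n => (ContinuousLinearMap.le_opNorm _ _).trans ?_) h0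
    rw [LinearIsometryEquiv.norm_map]
    gcongr
    exact hB n
  have := hz.add (hJ (Q ψ))
  simpa only [map_sub, sub_add_cancel, zero_add] using this

variable {P : ProjectionValuedMeasure H} {Pn : ∀ n, ProjectionValuedMeasure (Hn n)}

/-- Away from `0` the map `w ↦ Re (w⁻¹ + z)` is continuous. The point `0`, the image of `t = ∞`, is
left unrestricted because the limit measure does not charge it. -/
theorem frontier_setOf_inv_subset {K : Set ℂ} (z : ℂ) (Ω : Set ℝ) :
    frontier {w : K | (w : ℂ) ≠ 0 ∧ ((w : ℂ)⁻¹ + z).re ∈ Ω} ⊆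
      {w | (w : ℂ) ≠ 0 → ((w : ℂ)⁻¹ + z).re ∈ frontier Ω} := by
  intro w hw h0
  have hc : ContinuousAt (fun w : K => ((w : ℂ)⁻¹ + z).re) w :=
    Complex.continuous_re.continuousAt.comp
      ((continuous_subtype_val.continuousAt.inv₀ h0).add continuousAt_const)
  have hne : ∀ᶠ v : K in 𝓝 w, (v : ℂ) ≠ 0 := continuous_subtype_val.continuousAt.eventually_ne h0
  refine ⟨?_, fun hi => ?_⟩
  · by_contra hcl
    have h1 := hc.eventually_mem (isClosed_closure.isOpen_compl.mem_nhds hcl)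
    obtain ⟨v, hv, hv'⟩ := (mem_closure_iff_frequently.1 hw.1).and_eventually h1 |>.exists
    exact hv' (subset_closure hv.2)
  · have h1 := hc.eventually_mem (isOpen_interior.mem_nhds hi)
    refine hw.2 (mem_interior_iff_mem_nhds.2 ?_)
    filter_upwards [hne, h1] with v hv hv'
    exact ⟨hv, interior_subset hv'⟩

theorem tendsto_norm_proj_sq {z : ℂ} {T : H →L[ℂ] H} {Tn : ∀ n, Hn n →L[ℂ] Hn n} {C : ℝ}
    (hC : 0 ≤ C)
    (hJ : ∀ ψ : H, Tendsto (fun n => ContinuousLinearMap.adjoint (J n) (J n ψ)) atTop (𝓝 ψ))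
    (h : P.HasIntegral (fun t => ((t : ℂ) - z)⁻¹) T)
    (hn : ∀ n, (Pn n).HasIntegral (fun t => ((t : ℂ) - z)⁻¹) (Tn n))
    (hb : ∀ ψ, ∀ᵐ (t : ℝ) ∂(P.measure ψ), ‖((t : ℂ) - z)⁻¹‖ ≤ C)
    (hbn : ∀ n x, ∀ᵐ (t : ℝ) ∂((Pn n).measure x), ‖((t : ℂ) - z)⁻¹‖ ≤ C)
    (hz : ∀ ψ, ∀ᵐ (t : ℝ) ∂(P.measure ψ), (t : ℂ) ≠ z)
    (hzn : ∀ n x, ∀ᵐ (t : ℝ) ∂((Pn n).measure x), (t : ℂ) ≠ z)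
    (hT : ∀ ψ : H, Tendsto (fun n => ‖Tn n (J n ψ) - J n (T ψ)‖) atTop (𝓝 0))
    {Ω : Set ℝ} (hΩ : MeasurableSet Ω) (ψ : H) (hfr : P.measure ψ (frontier Ω) = 0) :
    Tendsto (fun n => ‖(Pn n).proj Ω (J n ψ)‖ ^ 2) atTop (𝓝 (‖P.proj Ω ψ‖ ^ 2)) := by
  let f : ℝ → ℂ := fun t => ((t : ℂ) - z)⁻¹
  have hfm : Measurable f := h.measurable
  let q : ℝ → Metric.closedBall (0 : ℂ) C := fun t =>
    ⟨if ‖f t‖ ≤ C then f t else 0, by split_ifs with h <;> simp [h, hC]⟩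
  have hq : Measurable q :=
    (Measurable.ite (measurableSet_le hfm.norm measurable_const) hfm measurable_const).subtype_mk
  have hqv {t : ℝ} (ht : ‖f t‖ ≤ C) : (q t : ℂ) = f t := if_pos ht
  have : CompactSpace (Metric.closedBall (0 : ℂ) C) :=
    isCompact_iff_compactSpace.1 (isCompact_closedBall _ _)
  have : Nonempty (Metric.closedBall (0 : ℂ) C) := ⟨q 0⟩
  let ν : FiniteMeasure (Metric.closedBall (0 : ℂ) C) :=
    ⟨(P.measure ψ).map q, inferInstance⟩
  let νn (n : ℕ) : FiniteMeasure (Metric.closedBall (0 : ℂ) C) :=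
    ⟨((Pn n).measure (J n ψ)).map q, inferInstance⟩
  have hν : Tendsto νn atTop (𝓝 ν) := by
    refine FiniteMeasure.tendsto_of_forall_integral_tendsto fun g => ?_
    let g' : C(Metric.closedBall (0 : ℂ) C, ℂ) :=
      ⟨fun w => (g w : ℂ), Complex.continuous_ofReal.comp g.continuous⟩
    have h1 := tendsto_integral_comp hJ h hn hq (fun χ => (hb χ).mono fun t ht => hqv ht)
      (fun n x => (hbn n x).mono fun t ht => hqv ht) hT g' ψ
    have h2 := (Complex.continuous_re.tendsto _).comp h1
    have e (μ : Measure ℝ) : (∫ t, g' (q t) ∂μ).re = ∫ w, g w ∂(μ.map q) := by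
      rw [integral_map hq.aemeasurable g.continuous.aestronglyMeasurable]
      exact (congrArg Complex.re integral_complex_ofReal).trans (Complex.ofReal_re _)
    rw [e] at h2
    exact h2.congr fun n => e _
  -- `B` corresponds to `Ω`, since `w⁻¹ + z = t` when `w = (t - z)⁻¹`. Taking the real part extends
  -- the condition from the curve of such `w` to the whole disk.
  let B : Set (Metric.closedBall (0 : ℂ) C) := {w | (w : ℂ) ≠ 0 ∧ ((w : ℂ)⁻¹ + z).re ∈ Ω}
  have hB : MeasurableSet B := by
    have h1 : Measurable fun w : Metric.closedBall (0 : ℂ) C => (w : ℂ) := measurable_subtype_coe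
    have h2 : Measurable fun w : Metric.closedBall (0 : ℂ) C => ((w : ℂ)⁻¹ + z).re :=
      Complex.measurable_re.comp (h1.inv.add_const z)
    exact (h1 (measurableSet_singleton 0)).compl.inter (h2 hΩ)
  have hqt {t : ℝ} (h1 : ‖f t‖ ≤ C) (h2 : (t : ℂ) ≠ z) :
      (q t : ℂ) ≠ 0 ∧ ((q t : ℂ)⁻¹ + z).re = t := by
    rw [hqv h1]
    refine ⟨inv_ne_zero (sub_ne_zero.2 h2), ?_⟩
    simp [f]
  have hpre {μ : Measure ℝ} (h1 : ∀ᵐ (t : ℝ) ∂μ, ‖f t‖ ≤ C) (h2 : ∀ᵐ (t : ℝ) ∂μ, (t : ℂ) ≠ z) :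
      μ.map q B = μ Ω := by
    rw [Measure.map_apply hq hB]
    refine measure_congr ?_
    filter_upwards [h1, h2] with t ht1 ht2
    obtain ⟨h3, h4⟩ := hqt ht1 ht2
    refine propext ⟨fun hw => ?_, fun hw => ⟨h3, ?_⟩⟩
    · have := hw.2
      rwa [h4] at this
    · rwa [h4]
  have hfrB : ν (frontier B) = 0 := by
    rw [FiniteMeasure.null_iff_toMeasure_null]
    change (P.measure ψ).map q (frontier B) = 0
    rw [Measure.map_apply hq isClosed_frontier.measurableSet]
    have hsub : q ⁻¹' frontier B ≤ᵐ[P.measure ψ] frontier Ω := by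
      filter_upwards [hb ψ, hz ψ] with t ht1 ht2 hw
      obtain ⟨h3, h4⟩ := hqt ht1 ht2
      have := frontier_setOf_inv_subset z Ω hw h3
      rwa [h4] at this
    exact measure_mono_null_ae hsub hfr
  have hlim := FiniteMeasure.tendsto_apply_of_null_frontier hν hfrB
  have hlim' := (NNReal.continuous_coe.tendsto _).comp hlim
  have e1 : ((ν B : NNReal) : ℝ) = ‖P.proj Ω ψ‖ ^ 2 := by
    rw [← P.measureReal_apply ψ hΩ]
    exact congrArg ENNReal.toReal (hpre (hb ψ) (hz ψ))
  have e2 (n : ℕ) : ((νn n B : NNReal) : ℝ) = ‖(Pn n).proj Ω (J n ψ)‖ ^ 2 := by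
    rw [← (Pn n).measureReal_apply (J n ψ) hΩ]
    exact congrArg ENNReal.toReal (hpre (hbn n _) (hzn n _))
  rw [e1] at hlim'
  exact hlim'.congr e2

/-- With `φ = R ψ` the inner product is `⟨(A - z) φ, φ⟩`, in which `⟨A φ, φ⟩` is real. -/
theorem ProjectionValuedMeasure.Represents.im_inner_resolvent {A : H →ₗ.[ℂ] H}
    (hP : P.Represents A) {z : ℂ} {R : H →L[ℂ] H} (hR : IsResolventAt A z R) (ψ : H) :
    (inner ℂ ψ (R ψ)).im = z.im * ‖R ψ‖ ^ 2 := by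
  obtain ⟨φ, h1, h2⟩ := hR.2 ψ
  rw [← h1]
  conv_lhs => rw [← h2]
  rw [inner_sub_left, hP.symmetric, hP.inner_apply, inner_smul_left,
    inner_self_eq_norm_sq_to_K]
  simp [← Complex.ofReal_pow]

theorem tendsto_norm_resolvent_sub {A : H →ₗ.[ℂ] H} {An : ∀ n, Hn n →ₗ.[ℂ] Hn n}
    (hP : P.Represents A) (hPn : ∀ n, (Pn n).Represents (An n)) {z : ℂ} (hz : z.im ≠ 0)
    {R : H →L[ℂ] H} {Rn : ∀ n, Hn n →L[ℂ] Hn n} (hR : IsResolventAt A z R)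
    (hRn : ∀ n, IsResolventAt (An n) z (Rn n))
    (hJ : ∀ ψ : H, Tendsto (fun n => ContinuousLinearMap.adjoint (J n) (J n ψ)) atTop (𝓝 ψ))
    (h : ∀ ψ : H, Tendsto (fun n => ContinuousLinearMap.adjoint (J n) (Rn n (J n ψ))) atTop
      (𝓝 (R ψ))) (ψ : H) :
    Tendsto (fun n => ‖Rn n (J n ψ) - J n (R ψ)‖) atTop (𝓝 0) := by
  have h1 (φ : H) : Tendsto (fun n => inner ℂ (J n φ) (Rn n (J n ψ))) atTop
      (𝓝 (inner ℂ φ (R ψ))) := by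
    simp only [← ContinuousLinearMap.adjoint_inner_right]
    exact tendsto_const_nhds.inner (h ψ)
  refine tendsto_norm_sub_of_tendsto_norm_sq hJ ?_ (h1 _)
  have h2 := ((Complex.continuous_im.tendsto _).comp (h1 ψ)).div_const z.im
  rw [hP.im_inner_resolvent hR, mul_div_cancel_left₀ _ hz] at h2
  refine h2.congr fun n => ?_
  rw [Function.comp_apply, (hPn n).im_inner_resolvent (hRn n), mul_div_cancel_left₀ _ hz]

end StrongConvergence

/-! ### Dimensions of ranges. -/

section DimRange

theorem natCast_le_dimRange_iff {H K : Type*} [NormedAddCommGroup H] [InnerProductSpace ℂ H]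
    [NormedAddCommGroup K] [InnerProductSpace ℂ K] {T : H →L[ℂ] K} {k : ℕ} :
    (k : ℝ≥0∞) ≤ dimRange T ↔ ∃ v : Fin k → H, LinearIndependent ℂ fun i => T (v i) := by
  rw [dimRange, ← ENat.toENNReal_coe, ENat.toENNReal_le, Cardinal.natCast_le_toENat,
    Module.le_rank_iff]
  constructor
  · rintro ⟨v, hv⟩
    choose w hw using fun i => (v i).2
    have h := hv.map' (Submodule.subtype _) (Submodule.ker_subtype _)
    have e : (Submodule.subtype _ ∘ v) = fun i => T (w i) := funext fun i => (hw i).symm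
    exact ⟨w, e ▸ h⟩
  · rintro ⟨v, hv⟩
    exact ⟨fun i => ⟨T (v i), v i, rfl⟩, LinearIndependent.of_comp (Submodule.subtype _) hv⟩

theorem dimRange_le_of_forall_natCast {H K : Type*} [NormedAddCommGroup H] [InnerProductSpace ℂ H]
    [NormedAddCommGroup K] [InnerProductSpace ℂ K] {T : H →L[ℂ] K} {x : ℝ≥0∞}
    (h : ∀ k : ℕ, (k : ℝ≥0∞) ≤ dimRange T → (k : ℝ≥0∞) ≤ x) : dimRange T ≤ x := by
  unfold dimRange at h ⊢
  generalize Cardinal.toENat (Module.rank ℂ (LinearMap.range (T : H →ₗ[ℂ] K))) = e at h ⊢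
  induction e using ENat.recTopCoe with
  | top =>
    rw [ENat.toENNReal_top, ← ENNReal.iSup_natCast]
    exact iSup_le fun k => h k (by simp)
  | coe n => simpa using h n (by simp)

theorem dimRange_comp_comp_le {H K L M : Type*} [NormedAddCommGroup H] [InnerProductSpace ℂ H]
    [NormedAddCommGroup K] [InnerProductSpace ℂ K] [NormedAddCommGroup L] [InnerProductSpace ℂ L]
    [NormedAddCommGroup M] [InnerProductSpace ℂ M]
    (S : L →L[ℂ] M) (T : K →L[ℂ] L) (J : H →L[ℂ] K) :
    dimRange (S.comp (T.comp J)) ≤ dimRange T := by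
  refine dimRange_le_of_forall_natCast fun k hk => ?_
  rw [natCast_le_dimRange_iff] at hk ⊢
  obtain ⟨v, hv⟩ := hk
  exact ⟨fun i => J (v i), LinearIndependent.of_comp (S : L →ₗ[ℂ] M) hv⟩

/-- Linear independence of finitely many vectors is an open condition, so `k` independent vectors `T
(v i)` remain independent for `Tn n` with large `n`. -/
theorem dimRange_le_liminf {H K : Type*} [NormedAddCommGroup H] [InnerProductSpace ℂ H]
    [NormedAddCommGroup K] [InnerProductSpace ℂ K] {T : H →L[ℂ] K} {Tn : ℕ → H →L[ℂ] K}
    (h : ∀ ψ, Tendsto (fun n => Tn n ψ) atTop (𝓝 (T ψ))) :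
    dimRange T ≤ liminf (fun n => dimRange (Tn n)) atTop := by
  refine dimRange_le_of_forall_natCast fun k hk => ?_
  obtain ⟨v, hv⟩ := natCast_le_dimRange_iff.1 hk
  have h1 : Tendsto (fun n i => Tn n (v i)) atTop (𝓝 fun i => T (v i)) :=
    tendsto_pi_nhds.2 fun i => h (v i)
  exact le_liminf_of_le (h := (h1.eventually hv.eventually).mono fun n hn =>
    natCast_le_dimRange_iff.2 ⟨v, hn⟩)

theorem liminf_dimRange_le {H : Type*} [NormedAddCommGroup H] [InnerProductSpace ℂ H]
    [CompleteSpace H] {Hn : ℕ → Type*} [∀ n, NormedAddCommGroup (Hn n)]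
    [∀ n, InnerProductSpace ℂ (Hn n)] [∀ n, CompleteSpace (Hn n)] {J : ∀ n, H →L[ℂ] Hn n}
    (hJ : ∀ ψ : H, Tendsto (fun n => ContinuousLinearMap.adjoint (J n) (J n ψ)) atTop (𝓝 ψ))
    (Tn : ∀ n, Hn n →L[ℂ] Hn n) :
    liminf (fun n => dimRange ((ContinuousLinearMap.adjoint (J n)).comp
      ((Tn n).comp (J n)))) atTop ≤
      limsup (fun n => ENNReal.ofReal (‖J n‖ ^ 2)) atTop *
        liminf (fun n => dimRange (Tn n)) atTop := by
  rcases subsingleton_or_nontrivial H with hH | hH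
  · have h0 (n : ℕ) : dimRange ((ContinuousLinearMap.adjoint (J n)).comp
        ((Tn n).comp (J n))) = 0 := by
      refine le_antisymm (dimRange_le_of_forall_natCast fun k hk => ?_) zero_le
      obtain ⟨v, hv⟩ := natCast_le_dimRange_iff.1 hk
      rcases Nat.eq_zero_or_pos k with rfl | hk
      · simp
      · exact absurd (Subsingleton.elim _ _) (hv.ne_zero ⟨0, hk⟩)
    simp [h0]
  · obtain ⟨ψ, hψ⟩ := exists_ne (0 : H)
    -- `‖J n‖ ≥ ‖J n ψ‖ / ‖ψ‖ → 1`. For `H = 0` this fails, but there the left side of the claim is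
    -- `0`.
    have h1 : 1 ≤ limsup (fun n => ENNReal.ofReal (‖J n‖ ^ 2)) atTop := by
      have h2 : Tendsto (fun n => ENNReal.ofReal ((‖J n ψ‖ / ‖ψ‖) ^ 2)) atTop (𝓝 1) := by
        have := ((tendsto_norm_map hJ ψ).div_const ‖ψ‖).pow 2
        rw [div_self (norm_ne_zero_iff.2 hψ), one_pow] at this
        simpa using ENNReal.tendsto_ofReal this
      rw [← h2.limsup_eq]
      refine limsup_le_limsup (Eventually.of_forall fun n => ENNReal.ofReal_le_ofReal ?_)
      gcongr
      exact (J n).ratio_le_opNorm ψ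
    calc _ ≤ liminf (fun n => dimRange (Tn n)) atTop :=
          liminf_le_liminf (Eventually.of_forall fun n => dimRange_comp_comp_le _ _ _)
      _ = 1 * liminf (fun n => dimRange (Tn n)) atTop := (one_mul _).symm
      _ ≤ _ := by gcongr

end DimRange

/-! ### Resolvents of self-adjoint operators off the real axis. -/

namespace UnboundedOp

variable {H : Type*} [NormedAddCommGroup H] [InnerProductSpace ℂ H] [CompleteSpace H]
  {A : H →ₗ.[ℂ] H}

theorem symmetric_of_isSelfAdjoint (hA : IsSelfAdjoint A) (φ ψ : A.domain) :
    inner ℂ (A φ) (ψ : H) = inner ℂ (φ : H) (A ψ) := by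
  have h := LinearPMap.adjoint_isFormalAdjoint hA.dense_domain
  rw [LinearPMap.isSelfAdjoint_def.1 hA] at h
  exact h φ ψ

theorem im_inner_self_of_isSelfAdjoint (hA : IsSelfAdjoint A) (φ : A.domain) :
    (inner ℂ (φ : H) (A φ)).im = 0 := by
  rw [← Complex.conj_eq_iff_im, inner_conj_symm, symmetric_of_isSelfAdjoint hA]

theorem abs_im_mul_norm_le (hA : IsSelfAdjoint A) (z : ℂ) (φ : A.domain) :
    |z.im| * ‖(φ : H)‖ ≤ ‖A φ - z • (φ : H)‖ := by
  have h1 : (inner ℂ (φ : H) (A φ - z • (φ : H))).im = -(z.im * ‖(φ : H)‖ ^ 2) := by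
    rw [inner_sub_right, inner_smul_right, inner_self_eq_norm_sq_to_K, Complex.sub_im,
      im_inner_self_of_isSelfAdjoint hA]
    simp [← Complex.ofReal_pow]
  have h2 := (Complex.abs_im_le_norm _).trans (norm_inner_le_norm (𝕜 := ℂ) (φ : H)
    (A φ - z • (φ : H)))
  rw [h1, abs_neg, abs_mul, abs_of_nonneg (sq_nonneg ‖(φ : H)‖)] at h2
  rcases (norm_nonneg (φ : H)).eq_or_lt with h | h
  · rw [← h, mul_zero]
    exact norm_nonneg _
  · nlinarith

/-- The range is closed by the lower bound `abs_im_mul_norm_le` and closedness of `A`. It is dense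
because a vector orthogonal to it lies in the domain of `A* = A` and is an eigenvector for `z̄`,
which the same bound excludes. -/
theorem range_sub_smul_eq_top (hA : IsSelfAdjoint A) {z : ℂ} (hz : z.im ≠ 0) :
    LinearMap.range (A.toFun - z • A.domain.subtype) = ⊤ := by
  have hz' : 0 < |z.im| := abs_pos.2 hz
  set L := A.toFun - z • A.domain.subtype with hL
  have hLa (φ : A.domain) : L φ = A φ - z • (φ : H) := rfl
  have hcl : IsClosed (LinearMap.range L : Set H) := by
    refine IsSeqClosed.isClosed fun y y₀ hy hlim => ?_
    choose φ hφ using hy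
    have hanti (m n : ℕ) : dist (φ m : H) (φ n) ≤ |z.im|⁻¹ * dist (y m) (y n) := by
      have := abs_im_mul_norm_le hA z (φ m - φ n)
      rw [← hLa, map_sub, hφ, hφ] at this
      rw [inv_mul_eq_div, le_div_iff₀ hz', mul_comm, dist_eq_norm, dist_eq_norm]
      exact this
    have hc : CauchySeq fun n => (φ n : H) := by
      refine Metric.cauchySeq_iff'.2 fun ε hε => ?_
      obtain ⟨N, hN⟩ := Metric.cauchySeq_iff'.1 hlim.cauchySeq (|z.im| * ε) (by positivity)
      refine ⟨N, fun n hn => (hanti n N).trans_lt ?_⟩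
      rw [inv_mul_lt_iff₀ hz']
      exact hN n hn
    obtain ⟨φ₀, hφ₀⟩ := cauchySeq_tendsto_of_complete hc
    have hA₀ : Tendsto (fun n => A (φ n)) atTop (𝓝 (y₀ + z • φ₀)) := by
      refine (hlim.add (hφ₀.const_smul z)).congr fun n => ?_
      rw [← hφ, hLa, sub_add_cancel]
    have hmem : (φ₀, y₀ + z • φ₀) ∈ (A.graph : Set (H × H)) :=
      hA.isClosed.mem_of_tendsto (hφ₀.prodMk_nhds hA₀)
        (Eventually.of_forall fun n => A.mem_graph (φ n))
    obtain ⟨x, hx1, hx2⟩ := (LinearPMap.mem_graph_iff A).1 hmem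
    refine ⟨x, ?_⟩
    simp only at hx1 hx2
    rw [hLa, hx1, hx2, add_sub_cancel_right]
  have hbot : (LinearMap.range L)ᗮ = ⊥ := by
    rw [Submodule.eq_bot_iff]
    intro η hη
    have h1 (φ : A.domain) : inner ℂ (starRingEnd ℂ z • η) (φ : H) = inner ℂ η (A φ) := by
      have := (Submodule.mem_orthogonal' _ _).1 hη _ ⟨φ, rfl⟩
      rw [hLa, inner_sub_right, inner_smul_right, sub_eq_zero] at this
      rw [this, inner_smul_left, Complex.conj_conj]
    have h2 : η ∈ (LinearPMap.adjoint A).domain := LinearPMap.mem_adjoint_domain_of_exists η ⟨_, h1⟩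
    have h3 := LinearPMap.adjoint_apply_eq hA.dense_domain ⟨η, h2⟩ h1
    have h4 : ∃ φ : A.domain, (φ : H) = η ∧ A φ = starRingEnd ℂ z • η := by
      have hg : (η, starRingEnd ℂ z • η) ∈ (LinearPMap.adjoint A).graph := by
        rw [← h3]
        exact (LinearPMap.adjoint A).mem_graph ⟨η, h2⟩
      rw [LinearPMap.isSelfAdjoint_def.1 hA] at hg
      exact (LinearPMap.mem_graph_iff A).1 hg
    obtain ⟨φ, h5, h6⟩ := h4
    have h7 := abs_im_mul_norm_le hA (starRingEnd ℂ z) φ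
    rw [h5, h6, sub_self, norm_zero, Complex.conj_im, abs_neg] at h7
    have := norm_nonneg η
    exact norm_eq_zero.1 (by nlinarith)
  have := hcl.submodule_topologicalClosure_eq
  rw [← this]
  exact (Submodule.topologicalClosure_eq_top_iff).2 hbot

theorem exists_isResolventAt (hA : IsSelfAdjoint A) {z : ℂ} (hz : z.im ≠ 0) :
    ∃ R, IsResolventAt A z R := by
  have hz' : 0 < |z.im| := abs_pos.2 hz
  let L := A.toFun - z • A.domain.subtype
  have hLa (φ : A.domain) : L φ = A φ - z • (φ : H) := rfl
  have hinj : Function.Injective L := by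
    rw [injective_iff_map_eq_zero]
    intro φ hφ
    have := abs_im_mul_norm_le hA z φ
    rw [← hLa, hφ, norm_zero] at this
    have h0 := norm_nonneg (φ : H)
    exact Subtype.ext (norm_eq_zero.1 (by nlinarith))
  let e := LinearEquiv.ofBijective L ⟨hinj, LinearMap.range_eq_top.1 (range_sub_smul_eq_top hA hz)⟩
  have he (ψ : H) : L (e.symm ψ) = ψ := e.apply_symm_apply ψ
  refine ⟨(A.domain.subtype.comp e.symm.toLinearMap).mkContinuous |z.im|⁻¹ fun ψ => ?_,
    fun ψ => ?_, fun ψ => ⟨e.symm ψ, rfl, he ψ⟩⟩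
  · have := abs_im_mul_norm_le hA z (e.symm ψ)
    rw [← hLa, he] at this
    rw [inv_mul_eq_div, le_div_iff₀ hz', mul_comm]
    exact this
  · exact congrArg Subtype.val (e.symm_apply_apply ψ)

omit [CompleteSpace H] in
theorem IsResolventAt.apply_sub_apply {z w : ℂ} {R S : H →L[ℂ] H} (hR : IsResolventAt A z R)
    (hS : IsResolventAt A w S) (ψ : H) : R ψ - S ψ = (z - w) • R (S ψ) := by
  obtain ⟨φ, h1, h2⟩ := hS.2 ψ
  have h3 := hR.1 φ
  rw [map_sub, map_smul] at h3
  rw [← h1]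
  conv_lhs => rw [← h2]
  rw [map_sub, map_smul, sub_eq_iff_eq_add.1 h3, sub_smul]
  abel

theorem IsResolventAt.adjoint_eq (hA : IsSelfAdjoint A) {z : ℂ} {R S : H →L[ℂ] H}
    (hR : IsResolventAt A z R) (hS : IsResolventAt A (starRingEnd ℂ z) S) :
    ContinuousLinearMap.adjoint R = S := by
  refine ((ContinuousLinearMap.eq_adjoint_iff S R).2 fun ψ φ => ?_).symm
  obtain ⟨u, h1, h2⟩ := hS.2 ψ
  obtain ⟨v, h3, h4⟩ := hR.2 φ
  rw [← h1, ← h3, ← h2, ← h4, inner_sub_left, inner_sub_right, symmetric_of_isSelfAdjoint hA,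
    inner_smul_left, inner_smul_right, Complex.conj_conj]

/-- The resolvent of a self-adjoint operator at `i` is normal, and its imaginary part is `R* R`. -/
theorem exists_resolvent_I (hA : IsSelfAdjoint A) : ∃ R : H →L[ℂ] H, IsResolventAt A Complex.I R ∧
    IsStarNormal R ∧ R - star R = (2 * Complex.I) • (star R * R) := by
  obtain ⟨R, hR⟩ := exists_isResolventAt hA (z := Complex.I) (by simp)
  obtain ⟨S, hS⟩ := exists_isResolventAt hA (z := starRingEnd ℂ Complex.I) (by simp)
  have hRS : star R = S := hR.adjoint_eq hA hS
  -- The resolvent identity in both orders gives `R - S = 2i R S = 2i S R`: this yields normality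
  -- and the formula for the imaginary part at once.
  have h1 (ψ : H) := hR.apply_sub_apply hS ψ
  have h2 (ψ : H) := hS.apply_sub_apply hR ψ
  rw [Complex.conj_I] at h1 h2
  refine ⟨R, hR, ⟨?_⟩, ?_⟩
  · rw [hRS]
    ext ψ
    have h3 := h1 ψ
    rw [← neg_sub, h2 ψ, ← neg_smul, neg_sub] at h3
    exact smul_right_injective H (by simp [sub_neg_eq_add, ← two_mul] : Complex.I - -Complex.I ≠ 0) h3
  · rw [hRS]
    ext ψ
    have h3 := h2 ψ
    rw [← neg_inj, neg_sub] at h3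
    rw [sub_apply, h3, ← neg_smul, smul_apply, mul_apply_eq_comp]
    congr 1
    ring

end UnboundedOp

/-! ### Measures and projections from a functional calculus on a compact space. -/

section FunctionalCalculus

open scoped CompactlySupported

variable {H : Type*} [NormedAddCommGroup H] [InnerProductSpace ℂ H] [CompleteSpace H]
  {K : Type*} [MetricSpace K] [CompactSpace K]

omit [CompactSpace K] in
theorem inner_map_self_nonneg_of_nonneg (Φ : C(K, ℂ) →⋆ₐ[ℂ] (H →L[ℂ] H)) {g : C(K, ℂ)}
    (f : C(K, ℝ)) (hf : ∀ w, 0 ≤ f w) (hg : ∀ w, g w = f w) (ψ : H) :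
    0 ≤ (inner ℂ ψ (Φ g ψ)).re := by
  let s : C(K, ℂ) := ⟨fun w => (Real.sqrt (f w) : ℂ),
    Complex.continuous_ofReal.comp (Real.continuous_sqrt.comp f.continuous)⟩
  have hs : g = star s * s := by
    ext w
    have : ((Real.sqrt (f w) : ℝ) : ℂ) * (Real.sqrt (f w) : ℝ) = f w := by
      rw [← Complex.ofReal_mul, Real.mul_self_sqrt (hf w)]
    simp [s, hg, this]
  rw [hs, map_mul, map_star, mul_apply_eq_comp, ContinuousLinearMap.star_eq_adjoint,
    ContinuousLinearMap.adjoint_inner_right]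
  exact inner_self_nonneg (𝕜 := ℂ)

/-- The inclusion of real functions into complex functions. -/
def toComplexMap (f : C_c(K, ℝ)) : C(K, ℂ) :=
  ⟨fun w => (f w : ℂ), Complex.continuous_ofReal.comp f.continuous⟩

/-- The functional `f ↦ ⟨ψ, Φ(f) ψ⟩` on real continuous functions. -/
def diagonalFunctional (Φ : C(K, ℂ) →⋆ₐ[ℂ] (H →L[ℂ] H)) (ψ : H) : C_c(K, ℝ) →ₚ[ℝ] ℝ :=
  PositiveLinearMap.mk₀
    { toFun := fun f => (inner ℂ ψ (Φ (toComplexMap f) ψ)).re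
      map_add' := fun f g => by
        have : toComplexMap (f + g) = toComplexMap f + toComplexMap g := by
          ext w; simp [toComplexMap]
        rw [this, map_add, add_apply, inner_add_right, Complex.add_re]
      map_smul' := fun c f => by
        have : toComplexMap (c • f) = (c : ℂ) • toComplexMap f := by
          ext w; simp [toComplexMap]
        rw [this, map_smul, smul_apply, inner_smul_right]
        simp }
    fun f hf => inner_map_self_nonneg_of_nonneg Φ ⟨f, f.continuous⟩ hf (fun w => rfl) ψ

variable [MeasurableSpace K] [BorelSpace K]

/-- The measure `ν` with `∫ g dν = ⟨ψ, Φ(g) ψ⟩`. -/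
def diagonalMeasure (Φ : C(K, ℂ) →⋆ₐ[ℂ] (H →L[ℂ] H)) (ψ : H) : Measure K :=
  RealRMK.rieszMeasure (diagonalFunctional Φ ψ)

instance (Φ : C(K, ℂ) →⋆ₐ[ℂ] (H →L[ℂ] H)) (ψ : H) : IsFiniteMeasure (diagonalMeasure Φ ψ) :=
  inferInstanceAs (IsFiniteMeasure (RealRMK.rieszMeasure (diagonalFunctional Φ ψ)))

variable (Φ : C(K, ℂ) →⋆ₐ[ℂ] (H →L[ℂ] H))

theorem integrable_continuousMap (g : C(K, ℂ)) (μ : Measure K) [IsFiniteMeasure μ] :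
    Integrable g μ :=
  Integrable.of_bound g.continuous.aestronglyMeasurable ‖g‖
    (Eventually.of_forall g.norm_coe_le_norm)

theorem inner_map_self_eq_integral (g : C(K, ℂ)) (ψ : H) :
    inner ℂ ψ (Φ g ψ) = ∫ w, g w ∂(diagonalMeasure Φ ψ) := by
  have hr (f : C_c(K, ℝ)) : inner ℂ ψ (Φ (toComplexMap f) ψ) =
      ((∫ w, f w ∂(diagonalMeasure Φ ψ) : ℝ) : ℂ) := by
    have h1 : ∫ w, f w ∂(diagonalMeasure Φ ψ) = (inner ℂ ψ (Φ (toComplexMap f) ψ)).re :=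
      RealRMK.integral_rieszMeasure (diagonalFunctional Φ ψ) f
    have h2 : star (toComplexMap f) = toComplexMap f := by
      ext w; simp [toComplexMap]
    rw [h1, eq_comm, ← Complex.conj_eq_iff_re, inner_conj_symm,
      ← ContinuousLinearMap.adjoint_inner_right, ← ContinuousLinearMap.star_eq_adjoint,
      ← map_star, h2]
  let gr : C_c(K, ℝ) := ⟨⟨fun w => (g w).re, Complex.continuous_re.comp g.continuous⟩,
    HasCompactSupport.of_compactSpace _⟩
  let gi : C_c(K, ℝ) := ⟨⟨fun w => (g w).im, Complex.continuous_im.comp g.continuous⟩,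
    HasCompactSupport.of_compactSpace _⟩
  have hg : g = toComplexMap gr + Complex.I • toComplexMap gi := by
    ext w
    simp only [ContinuousMap.add_apply, ContinuousMap.smul_apply, smul_eq_mul]
    rw [mul_comm]
    exact (Complex.re_add_im (g w)).symm
  conv_lhs => rw [hg]
  rw [map_add, map_smul, add_apply, smul_apply, inner_add_right, inner_smul_right, hr, hr]
  have := integral_re_add_im (integrable_continuousMap g (diagonalMeasure Φ ψ))
  rw [← this, mul_comm]
  rfl

theorem norm_sq_map_apply (g : C(K, ℂ)) (ψ : H) :
    ‖Φ g ψ‖ ^ 2 = ∫ w, ‖g w‖ ^ 2 ∂(diagonalMeasure Φ ψ) := by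
  have h := inner_map_self_eq_integral Φ (star g * g) ψ
  rw [map_mul, map_star, mul_apply_eq_comp, ContinuousLinearMap.star_eq_adjoint,
    ContinuousLinearMap.adjoint_inner_right, inner_self_eq_norm_sq_to_K] at h
  have h2 : ∫ w, (star g * g) w ∂(diagonalMeasure Φ ψ) =
      ((∫ w, ‖g w‖ ^ 2 ∂(diagonalMeasure Φ ψ) : ℝ) : ℂ) := by
    rw [← integral_complex_ofReal]
    congr 1 with w
    simp [Complex.conj_mul']
  rw [h2] at h
  exact Complex.ofReal_injective (by simpa using h)

theorem measureReal_diagonalMeasure_univ (ψ : H) :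
    (diagonalMeasure Φ ψ).real Set.univ = ‖ψ‖ ^ 2 := by
  have := norm_sq_map_apply Φ 1 ψ
  simpa using this.symm

omit [InnerProductSpace ℂ H] [CompleteSpace H] in
theorem sq_eq_integral_of_enorm_eq_eLpNorm {X : Type*} [MeasurableSpace X] {μ : Measure X}
    {f : X → ℂ} (hf : MemLp f 2 μ) {x : H} (h : ‖x‖ₑ = eLpNorm f 2 μ) :
    ‖x‖ ^ 2 = ∫ w, ‖f w‖ ^ 2 ∂μ := by
  rw [hf.eLpNorm_eq_integral_rpow_norm (by simp) (by simp), ← ofReal_norm] at h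
  have h0 : 0 ≤ ∫ w, ‖f w‖ ^ 2 ∂μ := integral_nonneg fun w => by positivity
  have h1 := (ENNReal.ofReal_eq_ofReal_iff (norm_nonneg _) (by positivity)).1 h
  rw [h1]
  simp only [ENNReal.toReal_ofNat, Real.rpow_ofNat]
  rw [← Real.rpow_natCast, ← Real.rpow_mul h0]
  simp

/-- `v = Φ(h) ψ` for a function `h` in `L²` of the diagonal measure of `ψ`. -/
structure IsExtension (ψ : H) (h : K → ℂ) (v : H) : Prop where
  memLp : MemLp h 2 (diagonalMeasure Φ ψ)
  enorm_eq : ∀ g : C(K, ℂ), ‖Φ g ψ - v‖ₑ = eLpNorm (⇑g - h) 2 (diagonalMeasure Φ ψ)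

variable {Φ}

theorem memLp_continuousMap (g : C(K, ℂ)) (μ : Measure K) [IsFiniteMeasure μ] : MemLp g 2 μ :=
  MemLp.of_bound g.continuous.aestronglyMeasurable ‖g‖ (Eventually.of_forall g.norm_coe_le_norm)

/-- By `norm_sq_map_apply`, `g ↦ Φ g ψ` is isometric for the `L²` norm of the diagonal measure;
continuous functions are dense, so it extends. -/
theorem exists_isExtension {ψ : H} {h : K → ℂ} (hh : MemLp h 2 (diagonalMeasure Φ ψ)) :
    ∃ v, IsExtension Φ ψ h v := by
  let μ := diagonalMeasure Φ ψ
  let e : C(K, ℂ) →ₗ[ℂ] Lp ℂ 2 μ := (ContinuousMap.toLp 2 μ ℂ).toLinearMap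
  let F : C(K, ℂ) →ₗ[ℂ] H :=
    { toFun := fun g => Φ g ψ
      map_add' := fun f g => by simp
      map_smul' := fun c g => by simp }
  have he (g : C(K, ℂ)) : e g = (memLp_continuousMap g μ).toLp :=
    Lp.ext ((ContinuousMap.coeFn_toLp μ g).trans (memLp_continuousMap g μ).coeFn_toLp.symm)
  have hd : DenseRange e := ContinuousMap.toLp_denseRange ℂ μ ℂ (by simp)
  have hn (g : C(K, ℂ)) : ‖F g‖ = ‖e g‖ := by
    have h1 : ‖F g‖ ^ 2 = ‖e g‖ ^ 2 := by
      rw [sq_eq_integral_of_enorm_eq_eLpNorm (memLp_continuousMap g μ) (x := e g)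
        (by rw [he, Lp.enorm_toLp])]
      exact norm_sq_map_apply Φ g ψ
    exact (sq_eq_sq₀ (norm_nonneg _) (norm_nonneg _)).1 h1
  let U := F.extendOfNorm e
  have hU (g : C(K, ℂ)) : U (e g) = F g :=
    LinearMap.extendOfNorm_eq hd ⟨1, fun g => by rw [hn, one_mul]⟩ g
  have hUn (x : Lp ℂ 2 μ) : ‖U x‖ = ‖x‖ :=
    hd.induction_on x (isClosed_eq U.continuous.norm continuous_norm) fun g => by rw [hU, hn]
  refine ⟨U hh.toLp, hh, fun g => ?_⟩
  change ‖F g - _‖ₑ = _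
  rw [← hU, ← map_sub, ← ofReal_norm, hUn, ofReal_norm, he, ← MemLp.toLp_sub, Lp.enorm_toLp]

/-- Approximating `h` in `L²` of the sum of the three measures gives one sequence that serves all
three vectors. This makes the extension linear in `ψ`. -/
theorem exists_tendsto_of_isExtension {ψ₁ ψ₂ ψ₃ v₁ v₂ v₃ : H} {h : K → ℂ}
    (h₁ : IsExtension Φ ψ₁ h v₁) (h₂ : IsExtension Φ ψ₂ h v₂) (h₃ : IsExtension Φ ψ₃ h v₃) :
    ∃ g : ℕ → C(K, ℂ), Tendsto (fun n => Φ (g n) ψ₁) atTop (𝓝 v₁) ∧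
      Tendsto (fun n => Φ (g n) ψ₂) atTop (𝓝 v₂) ∧
      Tendsto (fun n => Φ (g n) ψ₃) atTop (𝓝 v₃) := by
  let m := diagonalMeasure Φ ψ₁ + diagonalMeasure Φ ψ₂ + diagonalMeasure Φ ψ₃
  have hm : MemLp h 2 m := by
    have hs := (h₁.memLp.1.add_measure h₂.memLp.1).add_measure h₃.memLp.1
    refine (memLp_two_iff_integrable_sq_norm hs).2 ?_
    exact ((h₁.memLp.integrable_norm_pow (by simp)).add_measure
      (h₂.memLp.integrable_norm_pow (by simp))).add_measure
      (h₃.memLp.integrable_norm_pow (by simp))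
  have hex (n : ℕ) : ∃ g : C(K, ℂ), eLpNorm (⇑g - h) 2 m ≤ ((n : ℝ≥0∞) + 1)⁻¹ := by
    obtain ⟨g, hg, -⟩ := hm.exists_boundedContinuous_eLpNorm_sub_le (by simp)
      (ε := ((n : ℝ≥0∞) + 1)⁻¹) (by simp)
    refine ⟨g.toContinuousMap, ?_⟩
    rw [← eLpNorm_neg, neg_sub]
    exact hg
  choose g hg using hex
  have key {ψ v : H} (hψ : IsExtension Φ ψ h v) (hle : diagonalMeasure Φ ψ ≤ m) :
      Tendsto (fun n => Φ (g n) ψ) atTop (𝓝 v) := by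
    rw [tendsto_iff_edist_tendsto_0]
    refine tendsto_of_tendsto_of_tendsto_of_le_of_le tendsto_const_nhds
      (h := fun n : ℕ => ((n : ℝ≥0∞) + 1)⁻¹) ?_ (fun _ => zero_le) fun n => ?_
    · have := ENNReal.tendsto_inv_nat_nhds_zero.comp (tendsto_add_atTop_nat 1)
      simpa [Function.comp_def] using this
    · rw [edist_eq_enorm_sub, hψ.enorm_eq]
      exact (eLpNorm_mono_measure _ hle).trans (hg n)
  refine ⟨g, key h₁ ?_, key h₂ ?_, key h₃ ?_⟩
  · exact (Measure.le_add_right le_rfl).trans (Measure.le_add_right le_rfl)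
  · exact (Measure.le_add_left le_rfl).trans (Measure.le_add_right le_rfl)
  · exact Measure.le_add_left le_rfl

theorem isExtension_continuousMap (q : C(K, ℂ)) (ψ : H) : IsExtension Φ ψ q (Φ q ψ) := by
  obtain ⟨v, hv⟩ := exists_isExtension (Φ := Φ) (memLp_continuousMap q (diagonalMeasure Φ ψ))
  have h := hv.enorm_eq q
  rw [sub_self, eLpNorm_zero, enorm_eq_zero, sub_eq_zero] at h
  rwa [h]

theorem IsExtension.map_mul_apply {ψ v : H} {h : K → ℂ} (hv : IsExtension Φ ψ h v) {p q : C(K, ℂ)}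
    (hpq : ∀ᵐ w ∂(diagonalMeasure Φ ψ), p w * h w = q w) : Φ p v = Φ q ψ := by
  obtain ⟨g, hg, -, -⟩ := exists_tendsto_of_isExtension hv hv hv
  refine tendsto_nhds_unique (((Φ p).continuous.tendsto v).comp hg) ?_
  rw [tendsto_iff_edist_tendsto_0] at hg ⊢
  have h0 := ENNReal.Tendsto.const_mul hg (a := (‖p‖₊ : ℝ≥0∞)) (Or.inr ENNReal.coe_ne_top)
  rw [mul_zero] at h0
  refine tendsto_of_tendsto_of_tendsto_of_le_of_le tendsto_const_nhds h0 (fun _ => zero_le)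
    fun n => ?_
  have e : (Φ p ∘ fun n => Φ (g n) ψ) n = Φ (p * g n) ψ := by
    rw [map_mul, mul_apply_eq_comp, Function.comp_apply]
  simp only [e, edist_eq_enorm_sub]
  rw [(isExtension_continuousMap q ψ).enorm_eq, hv.enorm_eq]
  refine eLpNorm_le_nnreal_smul_eLpNorm_of_ae_le_mul ?_ 2
  filter_upwards [hpq] with w hw
  rw [Pi.sub_apply, ContinuousMap.mul_apply, ← hw, ← mul_sub, nnnorm_mul]
  gcongr
  · exact p.norm_coe_le_norm w
  · rfl

omit [MetricSpace K] [CompactSpace K] [BorelSpace K] in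
theorem memLp_indicator_one {E : Set K} (hE : MeasurableSet E) (μ : Measure K)
    [IsFiniteMeasure μ] : MemLp (E.indicator fun _ => (1 : ℂ)) 2 μ :=
  memLp_indicator_const 2 hE 1 (Or.inr (measure_ne_top _ _))

theorem IsExtension.norm_sq_eq {ψ v : H} {E : Set K} (hE : MeasurableSet E)
    (hv : IsExtension Φ ψ (E.indicator fun _ => 1) v) :
    ‖v‖ ^ 2 = (diagonalMeasure Φ ψ).real E ∧ inner ℂ ψ v = ((‖v‖ ^ 2 : ℝ) : ℂ) := by
  -- The distance from `c • ψ` to `v` is an explicit integral: `c = 0` gives `‖v‖²`, and `c = 1`, `c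
  -- = i` give the real and imaginary parts of `⟨ψ, v⟩`.
  have key (c : ℂ) : ‖c • ψ - v‖ ^ 2 = ‖c‖ ^ 2 * ‖ψ‖ ^ 2 +
      (1 - 2 * c.re) * (diagonalMeasure Φ ψ).real E := by
    have h1 := hv.enorm_eq (c • 1)
    rw [map_smul, map_one, smul_apply, one_apply_eq_self] at h1
    rw [sq_eq_integral_of_enorm_eq_eLpNorm ((memLp_continuousMap _ _).sub hv.memLp) h1]
    have h2 (w : K) : ‖(⇑(c • (1 : C(K, ℂ))) - E.indicator fun _ => (1 : ℂ)) w‖ ^ 2 =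
        ‖c‖ ^ 2 + E.indicator (fun _ => 1 - 2 * c.re) w := by
      by_cases hw : w ∈ E
      · simp only [Pi.sub_apply, Set.indicator_of_mem hw, ContinuousMap.smul_apply, ContinuousMap.one_apply,
          ← Complex.normSq_eq_norm_sq, Complex.normSq_apply]
        simp
        ring
      · simp [Set.indicator_of_notMem hw]
    simp only [h2]
    rw [integral_add (integrable_const _) ((integrable_const _).indicator hE),
      integral_indicator hE, setIntegral_const, integral_const, measureReal_diagonalMeasure_univ]
    simp only [smul_eq_mul]
    ring
  have h0 := key 0
  have h1 := key 1
  have h2 := key Complex.I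
  simp only [zero_smul, zero_sub, norm_neg, norm_zero, Complex.zero_re] at h0
  rw [one_smul, @norm_sub_sq ℂ] at h1
  rw [@norm_sub_sq ℂ, inner_smul_left, norm_smul] at h2
  simp at h0 h1 h2
  refine ⟨h0, Complex.ext ?_ ?_⟩
  · rw [Complex.ofReal_re]
    linarith
  · rw [Complex.ofReal_im]
    linarith

theorem exists_diagonal_projection (Φ : C(K, ℂ) →⋆ₐ[ℂ] (H →L[ℂ] H)) {E : Set K}
    (hE : MeasurableSet E) :
    ∃ Q : H →L[ℂ] H, IsStarProjection Q ∧ ∀ ψ, ‖Q ψ‖ ^ 2 = (diagonalMeasure Φ ψ).real E := by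
  choose v hv using fun ψ => exists_isExtension (memLp_indicator_one hE (diagonalMeasure Φ ψ))
  let L : H →ₗ[ℂ] H :=
    { toFun := v
      map_add' := fun ψ φ => by
        obtain ⟨g, h1, h2, h3⟩ := exists_tendsto_of_isExtension (hv ψ) (hv φ) (hv (ψ + φ))
        exact tendsto_nhds_unique h3 ((h1.add h2).congr fun n => (map_add _ _ _).symm)
      map_smul' := fun c ψ => by
        obtain ⟨g, h1, h2, -⟩ := exists_tendsto_of_isExtension (hv ψ) (hv (c • ψ)) (hv ψ)
        exact tendsto_nhds_unique h2 ((h1.const_smul c).congr fun n => (map_smul _ _ _).symm) }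
  have hb (ψ : H) : ‖L ψ‖ ≤ 1 * ‖ψ‖ := by
    rw [one_mul]
    refine le_of_sq_le_sq ?_ (norm_nonneg ψ)
    rw [← measureReal_diagonalMeasure_univ Φ ψ]
    exact ((hv ψ).norm_sq_eq hE).1.trans_le (measureReal_mono (Set.subset_univ E))
  let Q : H →L[ℂ] H := L.mkContinuous 1 hb
  have hQ (ψ : H) : inner ℂ ψ (Q ψ) = ((‖Q ψ‖ ^ 2 : ℝ) : ℂ) := ((hv ψ).norm_sq_eq hE).2
  -- `⟨ψ, Q ψ⟩ = ‖Q ψ‖²` says that `Q* Q` and `Q` have the same quadratic form; self-adjointness and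
  -- idempotence both follow.
  have hQQ : star Q * Q = Q := by
    refine ContinuousLinearMap.ext_inner_apply fun ψ => ?_
    rw [mul_apply_eq_comp, ContinuousLinearMap.star_eq_adjoint,
      ContinuousLinearMap.adjoint_inner_right, hQ, inner_self_eq_norm_sq_to_K]
    simp
  have hs : star Q = Q := by
    conv_lhs => rw [← hQQ]
    rw [star_mul, star_star, hQQ]
  rw [hs] at hQQ
  exact ⟨Q, ⟨hQQ, hs⟩, fun ψ => ((hv ψ).norm_sq_eq hE).1⟩

end FunctionalCalculus

/-! ### The spectral theorem. -/

theorem MeasureTheory.hasSum_measureReal_iUnion {X : Type*} [MeasurableSpace X] (μ : Measure X)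
    [IsFiniteMeasure μ] {E : ℕ → Set X} (hE : ∀ i, MeasurableSet (E i))
    (hd : Pairwise (Function.onFun Disjoint E)) :
    HasSum (fun i => μ.real (E i)) (μ.real (⋃ i, E i)) := by
  have h := measure_iUnion (μ := μ) hd hE
  rw [Measure.real, h, ENNReal.tsum_toReal_eq fun i => measure_ne_top _ _]
  exact ENNReal.hasSum_toReal (h ▸ measure_ne_top _ _)

/-- A family of projections whose diagonal elements are finite measures is a projection-valued
measure. -/
theorem exists_projectionValuedMeasure {H : Type*} [NormedAddCommGroup H] [InnerProductSpace ℂ H]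
    [CompleteSpace H] (μ : H → Measure ℝ) [∀ ψ, IsFiniteMeasure (μ ψ)]
    (huniv : ∀ ψ, (μ ψ).real Set.univ = ‖ψ‖ ^ 2)
    (h : ∀ E, MeasurableSet E → ∃ Q : H →L[ℂ] H, IsStarProjection Q ∧
      ∀ ψ, ‖Q ψ‖ ^ 2 = (μ ψ).real E) :
    ∃ P : ProjectionValuedMeasure H, ∀ ψ, P.measure ψ = μ ψ := by
  classical
  choose Q hQ hQμ using h
  have hin (E : Set ℝ) (hE : MeasurableSet E) (ψ : H) :
      inner ℂ ψ (Q E hE ψ) = (((μ ψ).real E : ℝ) : ℂ) := by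
    have h1 : star (Q E hE) * Q E hE = Q E hE := by
      rw [(hQ E hE).isSelfAdjoint.star_eq, (hQ E hE).isIdempotentElem.eq]
    rw [← hQμ E hE]
    conv_lhs => rw [← h1]
    rw [mul_apply_eq_comp, ContinuousLinearMap.star_eq_adjoint,
      ContinuousLinearMap.adjoint_inner_right, inner_self_eq_norm_sq_to_K]
    simp
  let P : ProjectionValuedMeasure H :=
    { proj := fun E => if hE : MeasurableSet E then Q E hE else 0
      isStarProjection := fun E hE => by
        rw [dif_pos hE]
        exact hQ E hE
      proj_of_not_measurableSet := fun E hE => dif_neg hE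
      proj_univ := by
        rw [dif_pos MeasurableSet.univ]
        refine ContinuousLinearMap.ext_inner_apply fun ψ => ?_
        rw [hin, huniv, one_apply_eq_self, inner_self_eq_norm_sq_to_K]
        simp
      hasSum_iUnion := fun E hE hd ψ => by
        simp only [dif_pos (hE _), dif_pos (MeasurableSet.iUnion hE)]
        have hU := MeasurableSet.iUnion hE
        have hm (s : Finset ℕ) : MeasurableSet ((⋃ i, E i) \ ⋃ i ∈ s, E i) :=
          hU.diff (s.measurableSet_biUnion fun i _ => hE i)
        have hr (s : Finset ℕ) (φ : H) : (μ φ).real ((⋃ i, E i) \ ⋃ i ∈ s, E i) =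
            (μ φ).real (⋃ i, E i) - ∑ i ∈ s, (μ φ).real (E i) := by
          rw [measureReal_sdiff (Set.iUnion₂_subset fun i _ => Set.subset_iUnion E i)
            (s.measurableSet_biUnion fun i _ => hE i),
            measureReal_biUnion_finset (fun i _ j _ hij => hd hij) fun i _ => hE i]
        -- Operators are determined by their quadratic forms, so additivity of the measures passes
        -- to the projections. The squared norm of the remainder is then a tail of a convergent
        -- series.
        have hop (s : Finset ℕ) : Q _ (hm s) = Q _ hU - ∑ i ∈ s, Q (E i) (hE i) := by
          refine ContinuousLinearMap.ext_inner_apply fun φ => ?_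
          rw [hin, hr, sub_apply, inner_sub_right, hin, sum_apply, inner_sum]
          simp only [hin]
          push_cast
          rfl
        have hs := MeasureTheory.hasSum_measureReal_iUnion (μ ψ) hE hd
        have h0 : Tendsto (fun s : Finset ℕ => ‖Q _ hU ψ - ∑ i ∈ s, Q (E i) (hE i) ψ‖ ^ 2) atTop
            (𝓝 0) := by
          have h1 := hs.const_sub ((μ ψ).real (⋃ i, E i))
          rw [sub_self] at h1
          refine h1.congr fun s => ?_
          rw [← hr, ← hQμ _ (hm s), hop, sub_apply, sum_apply]
        have h2 := h0.sqrt
        simp only [Real.sqrt_sq (norm_nonneg _), Real.sqrt_zero] at h2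
        rw [HasSum, tendsto_iff_norm_sub_tendsto_zero]
        exact h2.congr fun s => norm_sub_rev _ _ }
  refine ⟨P, fun ψ => ?_⟩
  ext E hE
  have h1 : P.proj E = Q E hE := dif_pos hE
  rw [P.measure_apply ψ hE, h1, hQμ E hE, ofReal_measureReal]

section SpectralTheorem

open ProjectionValuedMeasure

variable {H : Type*} [NormedAddCommGroup H] [InnerProductSpace ℂ H] [CompleteSpace H]

theorem diagonalMeasure_map_apply {K : Type*} [MetricSpace K] [CompactSpace K] [MeasurableSpace K]
    [BorelSpace K] (Φ : C(K, ℂ) →⋆ₐ[ℂ] (H →L[ℂ] H)) (p : C(K, ℂ)) (ψ : H) :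
    diagonalMeasure Φ (Φ p ψ) =
      (diagonalMeasure Φ ψ).withDensity fun w => ENNReal.ofReal (‖p w‖ ^ 2) := by
  have hm : Measurable fun w => ENNReal.ofReal (‖p w‖ ^ 2) := by
    have := p.continuous.measurable
    fun_prop
  have hfin : IsFiniteMeasure
      ((diagonalMeasure Φ ψ).withDensity fun w => ENNReal.ofReal (‖p w‖ ^ 2)) :=
    isFiniteMeasure_withDensity_ofReal
      ((memLp_continuousMap p _).integrable_norm_pow (by simp)).2
  refine ext_of_forall_integral_eq_of_IsFiniteMeasure fun f => ?_
  rw [integral_withDensity_eq_integral_toReal_smul hm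
    (Eventually.of_forall fun w => ENNReal.ofReal_lt_top)]
  let g : C(K, ℂ) := ⟨fun w => (f w : ℂ), Complex.continuous_ofReal.comp f.continuous⟩
  have h1 : inner ℂ (Φ p ψ) (Φ g (Φ p ψ)) = inner ℂ ψ (Φ (star p * (g * p)) ψ) := by
    rw [map_mul, map_mul, map_star, mul_apply_eq_comp, mul_apply_eq_comp,
      ContinuousLinearMap.star_eq_adjoint, ContinuousLinearMap.adjoint_inner_right]
  rw [inner_map_self_eq_integral, inner_map_self_eq_integral] at h1
  apply Complex.ofReal_injective
  rw [← integral_complex_ofReal, ← integral_complex_ofReal]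
  refine h1.trans (integral_congr_ae (Eventually.of_forall fun w => ?_))
  have h2 := Complex.conj_mul' (p w)
  simp only [ContinuousMap.mul_apply, ContinuousMap.star_apply, RCLike.star_def, smul_eq_mul]
  rw [ENNReal.toReal_ofReal (by positivity)]
  push_cast
  rw [← h2]
  simp only [g, ContinuousMap.coe_mk]
  ring

theorem Complex.sq_norm_mul_inv_re (w : ℂ) : ‖w‖ ^ 2 * (w⁻¹).re = w.re := by
  by_cases hw : w = 0
  · simp [hw]
  · rw [Complex.inv_re, ← Complex.normSq_eq_norm_sq,
      mul_div_cancel₀ _ (Complex.normSq_eq_zero.not.2 hw)]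

/-- The **spectral theorem**: every self-adjoint operator is represented by a projection-valued
measure. -/
theorem exists_represents {A : H →ₗ.[ℂ] H} (hA : IsSelfAdjoint A) :
    ∃ P : ProjectionValuedMeasure H, P.Represents A := by
  obtain ⟨T, hT, hn, him⟩ := UnboundedOp.exists_resolvent_I hA
  let K := spectrum ℂ T
  have : CompactSpace K := isCompact_iff_compactSpace.1 (spectrum.isCompact T)
  let Φ : C(K, ℂ) →⋆ₐ[ℂ] (H →L[ℂ] H) := cfcHom hn
  let X : C(K, ℂ) := ContinuousMap.restrict K (ContinuousMap.id ℂ)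
  have hΦX : Φ X = T := cfcHom_id hn
  have hX (w : K) : X w = w := rfl
  let ν := diagonalMeasure Φ
  -- The relation `T - T* = 2i T* T` puts the measure on the circle `Im w = |w|²`, the image of the
  -- real line under `t ↦ (t - i)⁻¹`.
  have hcirc (ψ : H) : ∀ᵐ (w : K) ∂(ν ψ), (w : ℂ).im = ‖(w : ℂ)‖ ^ 2 := by
    let p : C(K, ℂ) := X - star X - (2 * Complex.I) • (star X * X)
    have hp : Φ p = 0 := by
      rw [map_sub, map_sub, map_smul, map_mul, map_star, hΦX, him, sub_self]
    have h1 := norm_sq_map_apply Φ p ψ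
    rw [hp, zero_apply, norm_zero, eq_comm, zero_pow two_ne_zero,
      integral_eq_zero_iff_of_nonneg (fun w => by positivity)
      ((memLp_continuousMap p _).integrable_norm_pow (by simp))] at h1
    filter_upwards [h1] with w hw
    have h2 : p w = 0 := by simpa using hw
    have h3 : (w : ℂ) - starRingEnd ℂ w - 2 * Complex.I * (starRingEnd ℂ w * w) = 0 := h2
    rw [Complex.conj_mul', Complex.sub_conj] at h3
    have h4 : ((2 * (w : ℂ).im - 2 * ‖(w : ℂ)‖ ^ 2 : ℝ) : ℂ) * Complex.I = 0 := by
      rw [← h3]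
      push_cast
      ring
    rw [mul_eq_zero, or_iff_left Complex.I_ne_zero, Complex.ofReal_eq_zero] at h4
    linarith
  have hTinj (v : H) (hv : T v = 0) : v = 0 := by
    obtain ⟨φ, h1, h2⟩ := hT.2 v
    rw [hv] at h1
    have h3 : φ = 0 := Subtype.ext h1
    rw [← h2, h3]
    simp
  -- An atom at `0` would give a nonzero vector `v` with `T v = 0`, but `T` is injective.
  have hzero (ψ : H) : ∀ᵐ (w : K) ∂(ν ψ), (w : ℂ) ≠ 0 := by
    have hE : MeasurableSet {w : K | (w : ℂ) = 0} :=
      measurable_subtype_coe (measurableSet_singleton 0)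
    obtain ⟨v, hv⟩ := exists_isExtension (memLp_indicator_one hE (ν ψ))
    have h1 : Φ X v = Φ 0 ψ := hv.map_mul_apply (Eventually.of_forall fun w => by
      by_cases hw : (w : ℂ) = 0
      · simp [hX, hw]
      · simp [hw])
    rw [hΦX, map_zero, zero_apply] at h1
    have h2 := (hv.norm_sq_eq hE).1
    rw [hTinj v h1, norm_zero, zero_pow two_ne_zero, eq_comm, measureReal_eq_zero_iff] at h2
    rw [ae_iff]
    simpa using h2
  -- From `w = (t - i)⁻¹` one has `t = Re w⁻¹`; pushing forward along `b` moves the measures to the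
  -- line.
  let b : K → ℝ := fun w => ((w : ℂ)⁻¹).re
  have hb : Measurable b := Complex.measurable_re.comp measurable_subtype_coe.inv
  have hdens (η : H) : ν (T η) = (ν η).withDensity fun w => ENNReal.ofReal (‖(w : ℂ)‖ ^ 2) := by
    rw [← hΦX]
    exact diagonalMeasure_map_apply Φ X η
  have hdm : Measurable fun w : K => ENNReal.ofReal (‖(w : ℂ)‖ ^ 2) := by fun_prop
  obtain ⟨P, hP⟩ := exists_projectionValuedMeasure (fun ψ => (ν ψ).map b)
    (fun ψ => by
      rw [map_measureReal_apply hb MeasurableSet.univ]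
      exact measureReal_diagonalMeasure_univ Φ ψ)
    (fun E hE => by
      obtain ⟨Q, h1, h2⟩ := exists_diagonal_projection Φ (hb hE)
      exact ⟨Q, h1, fun ψ => by rw [h2, map_measureReal_apply hb hE]⟩)
  have hsq (ψ : H) : ∫⁻ t, ENNReal.ofReal (t ^ 2) ∂(P.measure ψ) =
      ∫⁻ w, ENNReal.ofReal (b w ^ 2) ∂(ν ψ) := by
    rw [hP, lintegral_map (by fun_prop) hb]
  refine ⟨P, fun ψ => ?_, fun ψ => ?_⟩
  · rw [hsq]
    constructor
    · intro hψ
      obtain ⟨η, rfl⟩ : ∃ η, T η = ψ := ⟨_, hT.1 ⟨ψ, hψ⟩⟩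
      rw [hdens, lintegral_withDensity_eq_lintegral_mul _ hdm (by fun_prop)]
      refine (lintegral_mono (g := fun _ => 1) fun w => ?_).trans_lt
        (by rw [lintegral_one]; exact measure_lt_top _ _)
      rw [Pi.mul_apply, ← ENNReal.ofReal_mul (by positivity), ENNReal.ofReal_le_one]
      rw [← mul_pow, sq_le_one_iff_abs_le_one, abs_mul, abs_norm]
      by_cases hw : (w : ℂ) = 0
      · simp [hw]
      · calc ‖(w : ℂ)‖ * |b w| ≤ ‖(w : ℂ)‖ * ‖(w : ℂ)⁻¹‖ := by
              gcongr
              exact Complex.abs_re_le_norm _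
          _ = 1 := by rw [norm_inv, mul_inv_cancel₀ (norm_ne_zero_iff.2 hw)]
    · intro hfin
      have hbi : Integrable (fun w => b w ^ 2) (ν ψ) :=
        (lintegral_ofReal_ne_top_iff_integrable (hb.pow_const 2).aestronglyMeasurable
          (Eventually.of_forall fun w => sq_nonneg _)).1 hfin.ne
      have hinv : Measurable fun w : K => (w : ℂ)⁻¹ := measurable_subtype_coe.inv
      -- On the circle `Im w⁻¹ = -1`, so `|w⁻¹|² = b² + 1` is integrable. The vector `v` obtained
      -- from `w⁻¹` then satisfies `T v = ψ`, and the range of `T` is the domain of `A`.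
      have hmem : MemLp (fun w : K => (w : ℂ)⁻¹) 2 (ν ψ) := by
        rw [memLp_two_iff_integrable_sq_norm hinv.aestronglyMeasurable]
        refine (hbi.add (integrable_const (1 : ℝ))).mono' (by fun_prop) ?_
        filter_upwards [hcirc ψ, hzero ψ] with w h1 h2
        have h3 : ((w : ℂ)⁻¹).im = -1 := by
          have : Complex.normSq (w : ℂ) ≠ 0 := Complex.normSq_eq_zero.not.2 h2
          rw [Complex.inv_im, h1, ← Complex.normSq_eq_norm_sq, neg_div, div_self this]
        rw [Real.norm_of_nonneg (by positivity), ← Complex.normSq_eq_norm_sq,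
          Complex.normSq_apply, h3]
        simp only [Pi.add_apply, b]
        nlinarith
      obtain ⟨v, hv⟩ := exists_isExtension hmem
      have h1 : Φ X v = Φ 1 ψ := hv.map_mul_apply (by
        filter_upwards [hzero ψ] with w hw
        rw [hX, mul_inv_cancel₀ hw, ContinuousMap.one_apply])
      rw [hΦX, map_one, one_apply_eq_self] at h1
      obtain ⟨φ, h2, -⟩ := hT.2 v
      rw [← h1, ← h2]
      exact φ.2
  · let η := A ψ - Complex.I • (ψ : H)
    have hη : T η = ψ := hT.1 ψ
    have hAψ : A ψ = η + Complex.I • (ψ : H) := (sub_add_cancel _ _).symm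
    have h1 : (inner ℂ (ψ : H) (A ψ)).re = ∫ t, t ∂(P.measure (ψ : H)) := by
      -- Here `A ψ = η + i ψ`, and the term `i ‖ψ‖²` has no real part.
      have h2 : (inner ℂ (ψ : H) (A ψ)).re = (inner ℂ η (T η)).re := by
        rw [hAψ, inner_add_right, inner_smul_right, inner_self_eq_norm_sq_to_K, hη,
          Complex.add_re]
        simpa [← Complex.ofReal_pow] using inner_re_symm (𝕜 := ℂ) (ψ : H) η
      have h3 : (inner ℂ η (T η)).re = ∫ w : K, (w : ℂ).re ∂(ν η) := by
        rw [← hΦX, inner_map_self_eq_integral]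
        exact (integral_re (integrable_continuousMap X (ν η))).symm
      rw [h2, h3, hP, ← hη, integral_map (f := fun t => t) hb.aemeasurable measurable_id.aestronglyMeasurable, hdens,
        integral_withDensity_eq_integral_toReal_smul hdm
          (Eventually.of_forall fun w => ENNReal.ofReal_lt_top)]
      congr 1 with w
      rw [ENNReal.toReal_ofReal (by positivity), smul_eq_mul, Complex.sq_norm_mul_inv_re]
    rw [← h1]
    exact Complex.ext rfl (UnboundedOp.im_inner_self_of_isSelfAdjoint hA ψ)

end SpectralTheorem

/-! ### Convergence of the spectral projections and the theorem. -/

section GenStrongResolventConv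

open UnboundedOp ProjectionValuedMeasure

/-- The measure chosen in the definition is itself a representing one, so uniqueness is not needed.
-/
theorem exists_represents_and_spectralProjection_eq {H : Type*} [NormedAddCommGroup H]
    [InnerProductSpace ℂ H] [CompleteSpace H] {A : H →ₗ.[ℂ] H} (hA : IsSelfAdjoint A) :
    ∃ P : ProjectionValuedMeasure H, P.Represents A ∧ spectralProjection A = P.proj := by
  have h := exists_represents hA
  refine ⟨h.choose, h.choose_spec, ?_⟩
  ext1 E
  rw [spectralProjection, dif_pos h]

variable {H : Type*} [NormedAddCommGroup H] [InnerProductSpace ℂ H] [CompleteSpace H]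
  {Hn : ℕ → Type*} [∀ n, NormedAddCommGroup (Hn n)] [∀ n, InnerProductSpace ℂ (Hn n)]
  [∀ n, CompleteSpace (Hn n)] {J : ∀ n, H →L[ℂ] Hn n}
  {P : ProjectionValuedMeasure H} {Pn : ∀ n, ProjectionValuedMeasure (Hn n)}
  {A : H →ₗ.[ℂ] H} {An : ∀ n, Hn n →ₗ.[ℂ] Hn n}

theorem GenStrongResolventConv.tendsto_proj (hconv : GenStrongResolventConv J An A)
    (hA : Dense (A.domain : Set H)) (hAn : ∀ n, Dense ((An n).domain : Set (Hn n)))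
    (hP : P.Represents A) (hPn : ∀ n, (Pn n).Represents (An n)) {Ω : Set ℝ}
    (hΩ : MeasurableSet Ω) (hfr : ∀ ψ, P.measure ψ (frontier Ω) = 0) (ψ : H) :
    Tendsto (fun n => ContinuousLinearMap.adjoint (J n) ((Pn n).proj Ω (J n ψ))) atTop
      (𝓝 (P.proj Ω ψ)) := by
  obtain ⟨B, hB⟩ := hconv.bounded
  have hJ := hconv.tendsto_adjoint_comp
  obtain ⟨z, hz, hlim, hreal⟩ := hconv.tendsto_resolvent
  -- The closure in the definition of `commonResolventSet` provides one `d` for all `n`, and thereby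
  -- a common disk.
  obtain ⟨d, hd, hball⟩ := Metric.isOpen_iff.1 isClosed_closure.isOpen_compl z hz
  have hdist {w : ℂ} (hw : w ∈ UnboundedOp.spectrum A ∪ ⋃ n, UnboundedOp.spectrum (An n)) :
      d ≤ ‖w - z‖ := by
    by_contra! h
    exact hball (mem_ball_iff_norm.2 h) (subset_closure hw)
  have hzA : z ∈ resolventSet A := by
    by_contra h
    exact hz (subset_closure (Or.inl h))
  have hzAn (n : ℕ) : z ∈ resolventSet (An n) := by
    by_contra h
    exact hz (subset_closure (Or.inr (Set.mem_iUnion.2 ⟨n, h⟩)))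
  obtain ⟨R, hR⟩ := id hzA
  choose Rn hRn using hzAn
  simp only [hR.resolvent_eq, (hRn _).resolvent_eq] at hlim hreal
  have hT (φ : H) : Tendsto (fun n => ‖Rn n (J n φ) - J n (R φ)‖) atTop (𝓝 0) := by
    by_cases him : z.im = 0
    · exact hreal him φ
    · exact tendsto_norm_resolvent_sub hP hPn him hR hRn hJ hlim φ
  refine tendsto_adjoint_comp_of_tendsto_norm_sq hB hJ (P.inner_proj_self hΩ)
    (fun n => (Pn n).inner_proj_self hΩ) (fun φ => ?_) ψ
  exact tendsto_norm_proj_sq (C := d⁻¹) (by positivity) hJ (hP.hasIntegral_resolvent hA hR)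
    (fun n => (hPn n).hasIntegral_resolvent (hAn n) (hRn n))
    (hP.ae_norm_inv_le hA hd fun w hw => hdist (Or.inl hw))
    (fun n => (hPn n).ae_norm_inv_le (hAn n) hd fun w hw =>
      hdist (Or.inr (Set.mem_iUnion.2 ⟨n, hw⟩)))
    (hP.ae_ne_of_mem_resolventSet hA hzA)
    (fun n => (hPn n).ae_ne_of_mem_resolventSet (hAn n) ⟨Rn n, hRn n⟩) hT hΩ φ (hfr φ)

end GenStrongResolventConv

end

theorem mainTheorem7 {H : Type*} [NormedAddCommGroup H] [InnerProductSpace ℂ H]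
    [CompleteSpace H] [TopologicalSpace.SeparableSpace H]
    {Hn : ℕ → Type*} [∀ n, NormedAddCommGroup (Hn n)] [∀ n, InnerProductSpace ℂ (Hn n)]
    [∀ n, CompleteSpace (Hn n)] [∀ n, TopologicalSpace.SeparableSpace (Hn n)]
    (J : ∀ n, H →L[ℂ] Hn n)
    (An : ∀ n, Hn n →ₗ.[ℂ] Hn n) (hAn : ∀ n, IsSelfAdjoint (An n))
    (A : H →ₗ.[ℂ] H) (hA : IsSelfAdjoint A)
    (hconv : GenStrongResolventConv J An A)
    (l₀ l₁ : ℝ)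
    (h₀ : UnboundedOp.spectralProjection A {l₀} = 0)
    (h₁ : UnboundedOp.spectralProjection A {l₁} = 0) :
    (∀ ψ : H, Tendsto (fun n => ContinuousLinearMap.adjoint (J n)
        (UnboundedOp.spectralProjection (An n) (Set.Ioo l₀ l₁) (J n ψ))) atTop
        (𝓝 (UnboundedOp.spectralProjection A (Set.Ioo l₀ l₁) ψ))) ∧
    (∀ ψ : H, Tendsto (fun n => ContinuousLinearMap.adjoint (J n)
        (UnboundedOp.spectralProjection (An n) (Set.Icc l₀ l₁) (J n ψ))) atTop
        (𝓝 (UnboundedOp.spectralProjection A (Set.Ioo l₀ l₁) ψ))) ∧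
    UnboundedOp.spectralProjection A (Set.Ioo l₀ l₁) =
      UnboundedOp.spectralProjection A (Set.Icc l₀ l₁) ∧
    dimRange (UnboundedOp.spectralProjection A (Set.Ioo l₀ l₁)) ≤
      liminf (fun n => dimRange ((ContinuousLinearMap.adjoint (J n)).comp
        ((UnboundedOp.spectralProjection (An n) (Set.Ioo l₀ l₁)).comp (J n)))) atTop ∧
    liminf (fun n => dimRange ((ContinuousLinearMap.adjoint (J n)).comp
        ((UnboundedOp.spectralProjection (An n) (Set.Ioo l₀ l₁)).comp (J n)))) atTop ≤
      limsup (fun n => ENNReal.ofReal (‖J n‖ ^ 2)) atTop *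
        liminf (fun n => dimRange
          (UnboundedOp.spectralProjection (An n) (Set.Ioo l₀ l₁))) atTop := by
  obtain ⟨P, hP, hPA⟩ := exists_represents_and_spectralProjection_eq hA
  choose Pn hPn hPAn using fun n => exists_represents_and_spectralProjection_eq (hAn n)
  simp only [hPA, hPAn] at h₀ h₁ ⊢
  have hend (ψ : H) : P.measure ψ {l₀, l₁} = 0 := by
    rw [Set.insert_eq, measure_union_null_iff, P.measure_apply ψ (measurableSet_singleton _),
      P.measure_apply ψ (measurableSet_singleton _), h₀, h₁]
    simp
  have hfrO (ψ : H) : P.measure ψ (frontier (Set.Ioo l₀ l₁)) = 0 := by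
    refine measure_mono_null (fun t ht => ?_) (hend ψ)
    -- No order between the endpoints is assumed; an empty interval has empty frontier.
    rcases lt_or_ge l₀ l₁ with h | h
    · rwa [frontier_Ioo h] at ht
    · simp [Set.Ioo_eq_empty_of_le h] at ht
  have hfrC (ψ : H) : P.measure ψ (frontier (Set.Icc l₀ l₁)) = 0 := by
    refine measure_mono_null (fun t ht => ?_) (hend ψ)
    rcases le_or_gt l₀ l₁ with h | h
    · rwa [frontier_Icc h] at ht
    · simp [Set.Icc_eq_empty_of_lt h] at ht
  have hEq : P.proj (Set.Ioo l₀ l₁) = P.proj (Set.Icc l₀ l₁) := by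
    refine ContinuousLinearMap.ext_inner_apply fun ψ => ?_
    rw [P.inner_proj_self measurableSet_Ioo, P.inner_proj_self measurableSet_Icc,
      ← P.measureReal_apply ψ measurableSet_Ioo, ← P.measureReal_apply ψ measurableSet_Icc]
    congr 1
    refine measureReal_congr (EventuallyEq.symm ?_)
    have h : ∀ᵐ t ∂(P.measure ψ), t ∉ ({l₀, l₁} : Set ℝ) := measure_eq_zero_iff_ae_notMem.1 (hend ψ)
    filter_upwards [h] with t ht
    simp only [Set.mem_insert_iff, Set.mem_singleton_iff, not_or] at ht
    exact propext ⟨fun h => ⟨h.1.lt_of_ne' ht.1, h.2.lt_of_ne ht.2⟩, fun h => ⟨h.1.le, h.2.le⟩⟩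
  have hO := hconv.tendsto_proj hA.dense_domain (fun n => (hAn n).dense_domain) hP hPn
    measurableSet_Ioo hfrO
  have hC := hconv.tendsto_proj hA.dense_domain (fun n => (hAn n).dense_domain) hP hPn
    measurableSet_Icc hfrC
  rw [← hEq] at hC
  exact ⟨hO, hC, hEq, dimRange_le_liminf hO, liminf_dimRange_le hconv.tendsto_adjoint_comp _⟩
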